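/- For a nonzero real vector $v$ let $\mathcal P_v(i)=(|v_i|/\|v\|)^2$, and let $\|p,q\|_{TV}=\frac12\sum_i|p(i)-q(i)|$. There is a universal constant $K>0$ such that the following holds. Let $H\in\mathbb R^{n\times m}$ have rank $k$, spectral norm $\|H\|_2\ge 1$ and condition number $\kappa=\|H\|_2/\sigma_{\min}(H)$, where $\sigma_{\min}(H)$ is the smallest nonzero singular value; let $B_t\in\mathbb R^m$ with $H_t:=HB_t\neq 0$; let $0<\varepsilon\le 1$, $0<\eta<1$, and $$s=\left\lceil\frac{85^2k^2\kappa^4\ln(8n/\eta)\,\|H\|_F^2}{9\varepsilon^2}\right\rceil .$$ Consider the following procedure. 1. Sample $s$ column indices $i_1,\dots,i_s$ of $H$ independently with probabilities $p_i=\|H(:,i)\|^2/\|H\|_F^2$, and let $R\in\mathbb R^{n\times s}$ have the columns $H(:,i_r)/\sqrt{s\,p_{i_r}}$. 2. Independently $s$ times, draw $r\in[s]$ uniformly and then a row index $j$ from $\mathcal P_{R(:,r)}$; let $C\in\mathbb R^{s\times s}$ have the rows $R(j_r,:)/\sqrt{s\,\|R(j_r,:)\|^2/\|R\|_F^2}$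 for the row indices $j_1,\dots,j_s$ obtained. 3. Apply any fixed singular value decomposition routine to $C$, and let $\sigma^{(1)}\ge\dots\ge\sigma^{(k)}$ and $\omega^{(1)},\dots,\omega^{(k)}$ be the $k$ leading singular values and right singular vectors of $C$. Let $\tilde V\in\mathbb R^{n\times k}$ have the columns $\tilde v^{(l)}=R\omega^{(l)}/\sigma^{(l)}$. 4. For each $l\in[k]$, estimate $\tilde v^{(l)\top}HB_t$ by the median $\hat q_l$ of $N_p$ means of $N_q$ independent samples each of the random variable that equals $\|\tilde v^{(l)}\|^2\|B_t\|^2H(a,b)/(\tilde v^{(l)}(a)B_t(b))$ with probability $\mathcal P_{\tilde v^{(l)}}(a)\,\mathcal P_{B_t}(b)$, where $N_q\ge K k\|H\|_F^2\|B_t\|^2/(\varepsilon\|H_t\|)^2$ and $N_p\ge K\ln(2k/\eta)$. 5. Put $\hat H_t=\tilde V\hat q$. Then, with probability at least $1-\eta$ over all the samples, every step is well defined, $\hat H_t\neq 0$, and $$\|\mathcal P_{\hat H_t},\mathcal P_{H_t}\|_{TV}\le\varepsilon .$$ -/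

import Mathlib

open scoped Matrix

noncomputable section

namespace ConicalHull

/-! ### Norms, condition number, length-square distributions -/

/-- The Euclidean norm of a real vector. -/
def vecNorm {ι : Type*} [Fintype ι] (v : ι → ℝ) : ℝ :=
  ‖(WithLp.toLp 2 v : EuclideanSpace ℝ ι)‖

open scoped Matrix.Norms.Frobenius in
/-- The Frobenius norm of a real matrix. -/
def frobNorm {n m : ℕ} (H : Matrix (Fin n) (Fin m) ℝ) : ℝ := ‖H‖

open scoped Matrix.Norms.L2Operator in
/-- The spectral norm of a real matrix. -/
def specNorm {n m : ℕ} (H : Matrix (Fin n) (Fin m) ℝ) : ℝ := ‖H‖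

/-- The smallest nonzero singular value of a nonzero real matrix: for a matrix of rank `k` it is
the `k`-th largest singular value (Mathlib numbers singular values from `0`). -/
def sigmaMin {n m : ℕ} (H : Matrix (Fin n) (Fin m) ℝ) : ℝ :=
  (Matrix.toEuclideanLin H).singularValues (H.rank - 1)

/-- The condition number of a nonzero real matrix. -/
def condNumber {n m : ℕ} (H : Matrix (Fin n) (Fin m) ℝ) : ℝ :=
  specNorm H / sigmaMin H

/-- The length-square distribution `P_v(i) = (|v i| / ‖v‖)²` of a nonzero vector `v`. For `v = 0`,
where there is no such distribution, all the weights are `0`. -/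
def lsDist {ι : Type*} [Fintype ι] (v : ι → ℝ) (i : ι) : ℝ :=
  (|v i| / vecNorm v) ^ 2

/-- The total variation distance of two weight functions on a finite set. -/
def tvDist {ι : Type*} [Fintype ι] (p q : ι → ℝ) : ℝ :=
  (1 / 2) * ∑ i, |p i - q i|

/-- The probability of the column index `i` in length-square column sampling from `H`. -/
def colProb {n m : ℕ} (H : Matrix (Fin n) (Fin m) ℝ) (i : Fin m) : ℝ :=
  (vecNorm (fun a => H a i) / frobNorm H) ^ 2

/-- The probability of the row index `j` in length-square row sampling from `R`. -/
def rowProb {n s : ℕ} (R : Matrix (Fin n) (Fin s) ℝ) (j : Fin n) : ℝ :=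
  (vecNorm (fun t => R j t) / frobNorm R) ^ 2

/-! ### The subsampling method -/

/-- The matrix `R`, whose `t`-th column is `H(:, c t) / √(s P(c t))`, for sampled column
indices `c`. -/
def sampledR {n m s : ℕ} (H : Matrix (Fin n) (Fin m) ℝ) (c : Fin s → Fin m) :
    Matrix (Fin n) (Fin s) ℝ :=
  Matrix.of fun a t => H a (c t) / √(s * colProb H (c t))

/-- The matrix `C`, whose `r`-th row is `R(j r, :) / √(s P(j r))`, for sampled row indices `j`. -/
def sampledC {n s : ℕ} (R : Matrix (Fin n) (Fin s) ℝ) (j : Fin s → Fin n) :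
    Matrix (Fin s) (Fin s) ℝ :=
  Matrix.of fun r t => R (j r) t / √(s * rowProb R (j r))

/-- The probability that `s` independent length-square column samples from `H` are `c`. -/
def colsWeight {n m s : ℕ} (H : Matrix (Fin n) (Fin m) ℝ) (c : Fin s → Fin m) : ℝ :=
  ∏ t, colProb H (c t)

/-- One row is sampled by drawing a column index `t` of `R` uniformly and then a row index `j`
from `P_{R(:, t)}`. This is the probability that `s` independent repetitions produce the pairs
`d r = (t, j)`. -/
def rowsWeight {n s : ℕ} (R : Matrix (Fin n) (Fin s) ℝ) (d : Fin s → Fin s × Fin n) : ℝ :=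
  ∏ r, (1 / (s : ℝ)) * lsDist (fun a => R a (d r).1) (d r).2

/-- A singular value decomposition `A = U diag(σ) Wᵀ` of a real square matrix, with the singular
values in decreasing order. -/
structure SVD {s : ℕ} (A : Matrix (Fin s) (Fin s) ℝ) where
  U : Matrix (Fin s) (Fin s) ℝ
  σ : Fin s → ℝ
  W : Matrix (Fin s) (Fin s) ℝ
  U_orthogonal : U ∈ Matrix.orthogonalGroup (Fin s) ℝ
  W_orthogonal : W ∈ Matrix.orthogonalGroup (Fin s) ℝ
  σ_nonneg : ∀ i, 0 ≤ σ i
  σ_antitone : Antitone σ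
  eq_mul : A = U * Matrix.diagonal σ * Wᵀ

/-- The approximate left singular matrix, whose `l`-th column is `R ω⁽ˡ⁾ / σ⁽ˡ⁾`, where `σ⁽ˡ⁾` and
`ω⁽ˡ⁾`, for the first `k` indices `l`, are the leading singular values and right singular vectors
of `C`. A column that cannot be formed (`σ⁽ˡ⁾ = 0`, or `l ≥ s`) is `0`. -/
def approxV {n s : ℕ} (k : ℕ) (R : Matrix (Fin n) (Fin s) ℝ) {C : Matrix (Fin s) (Fin s) ℝ}
    (D : SVD C) : Matrix (Fin n) (Fin k) ℝ :=
  Matrix.of fun a l =>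
    if h : l.1 < s then (R *ᵥ fun b => D.W b ⟨l.1, h⟩) a / D.σ ⟨l.1, h⟩ else 0

/-! ### The inner product subroutine -/

/-- The median of `N` real numbers (the mean of the two middle ones if `N` is even). -/
def median {N : ℕ} (x : Fin N → ℝ) : ℝ :=
  if h : 0 < N then
    (x (Tuple.sort x ⟨(N - 1) / 2, by omega⟩) + x (Tuple.sort x ⟨N / 2, by omega⟩)) / 2
  else 0

/-- The value at `(j, l)` of the random variable `Z` that estimates `vᵀ H B`. -/
def zValue {n m : ℕ} (H : Matrix (Fin n) (Fin m) ℝ) (B : Fin m → ℝ) (v : Fin n → ℝ)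
    (p : Fin n × Fin m) : ℝ :=
  vecNorm v ^ 2 * vecNorm B ^ 2 * H p.1 p.2 / (v p.1 * B p.2)

/-- The probability `P_v(j) P_B(l)` of the pair `(j, l)`. -/
def zProb {n m : ℕ} (B : Fin m → ℝ) (v : Fin n → ℝ) (p : Fin n × Fin m) : ℝ :=
  lsDist v p.1 * lsDist B p.2

/-- The output of the inner product subroutine: the median, over `Np` groups, of the means of `Nq`
samples of `Z`. -/
def medianOfMeans {n m Np Nq : ℕ} (H : Matrix (Fin n) (Fin m) ℝ) (B : Fin m → ℝ) (v : Fin n → ℝ)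
    (z : Fin Np → Fin Nq → Fin n × Fin m) : ℝ :=
  median fun a => (∑ b, zValue H B v (z a b)) / (Nq : ℝ)

/-- The vector `q̂`: one run of the inner product subroutine for each column of `V`. -/
def qHat {n m k Np Nq : ℕ} (H : Matrix (Fin n) (Fin m) ℝ) (B : Fin m → ℝ)
    (V : Matrix (Fin n) (Fin k) ℝ) (z : Fin k → Fin Np → Fin Nq → Fin n × Fin m) : Fin k → ℝ :=
  fun l => medianOfMeans H B (fun a => V a l) (z l)

/-- The probability that the independent samples used for `q̂` are `z`. -/
def samplesWeight {n m k Np Nq : ℕ} (B : Fin m → ℝ) (V : Matrix (Fin n) (Fin k) ℝ)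
    (z : Fin k → Fin Np → Fin Nq → Fin n × Fin m) : ℝ :=
  ∏ l, ∏ a, ∏ b, zProb B (fun i => V i l) (z l a b)

/-! ### The whole procedure -/

/-- The vector `Ĥ = Ṽ q̂` computed from the sampled column indices `c`, the sampled pairs `d`
(whose second components are the sampled row indices) and the inner product samples `z`. -/
def hHat {n m s Np Nq : ℕ} (k : ℕ) (H : Matrix (Fin n) (Fin m) ℝ) (B : Fin m → ℝ)
    (svd : ∀ A : Matrix (Fin s) (Fin s) ℝ, SVD A) (c : Fin s → Fin m) (d : Fin s → Fin s × Fin n)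
    (z : Fin k → Fin Np → Fin Nq → Fin n × Fin m) : Fin n → ℝ :=
  let R := sampledR H c
  let V := approxV k R (svd (sampledC R fun r => (d r).2))
  V *ᵥ qHat H B V z

open Classical in
/-- The probability that the procedure outputs a vector `Ĥ` with the property `good`: the sum of
the weights of the outcomes `(c, d, z)` for which `Ĥ` is good. Outcomes for which some sampling
distribution is undefined, because it would be the one of a zero vector, have weight `0`, so they
never count in favour of `good`. -/
def outputProb {n m : ℕ} (k s Np Nq : ℕ) (H : Matrix (Fin n) (Fin m) ℝ) (B : Fin m → ℝ)
    (svd : ∀ A : Matrix (Fin s) (Fin s) ℝ, SVD A) (good : (Fin n → ℝ) → Prop) : ℝ :=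
  ∑ c : Fin s → Fin m, ∑ d : Fin s → Fin s × Fin n,
    ∑ z : Fin k → Fin Np → Fin Nq → Fin n × Fin m,
      if good (hHat k H B svd c d z) then
        colsWeight H c * rowsWeight (sampledR H c) d *
          samplesWeight B (approxV k (sampledR H c)
            (svd (sampledC (sampledR H c) fun r => (d r).2))) z
      else 0

/-- The number of sampled columns and rows,
`85² k² κ⁴ ln(8n/η) ‖H‖_F² / (9 ε²)` rounded up, where `k` is the rank of `H`. -/
def sampleSize {n m : ℕ} (H : Matrix (Fin n) (Fin m) ℝ) (ε η : ℝ) : ℕ :=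
  ⌈85 ^ 2 * (H.rank : ℝ) ^ 2 * condNumber H ^ 4 * Real.log (8 * n / η) * frobNorm H ^ 2
    / (9 * ε ^ 2)⌉₊

end ConicalHull

end

/-!
The procedure succeeds because both sketches are accurate in Frobenius norm. For a sum of `N`
independent centred vectors of norm at most `b` in any inner product space, the expectation of
`cosh (L ‖·‖)` is at most `cosh (L b) ^ N`, by convexity of `cosh √·` (`sum_cosh_norm_add_le`). This
gives a dimension-free Hoeffding bound (`norm_sum_concentration`). Applied to the rank-one matrices
of length-square sampling, it bounds `‖R Rᵀ - H Hᵀ‖_F` and `‖Cᵀ C - Rᵀ R‖_F` by `ε σ_min² / 10`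
with probability at least `1 - η / 4` each (`sampledR_concentration`, `two_mul_exp_neg_le`). All
columns of `R` have the same norm, so the two-step row sampling is length-square sampling from `Rᵀ`,
and one lemma serves both sketches. The Frobenius norm is affordable since `‖H‖_F² ≤ k ‖H‖²` and the
sample size has a factor `k²`.

On that event the Courant–Fischer principle gives `σ⁽ᵏ⁾(C)² ≥ σ_min² - 2 θ`, where
`θ = ε σ_min² / 10` (`sigma_sq_lower_bound`). As `Ṽᵀ Ṽ - 1 = Pᵀ (Rᵀ R - Cᵀ C) P` with
`‖P‖ ≤ 1 / σ⁽ᵏ⁾(C)`, the columns of `Ṽ` are orthonormal up to `ε / 8` (`vecNorm_gram_sub_one_le`).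
They lie in the column space of `H`, whose dimension is their number `k`, so they span it
(`exists_mulVec_eq`). Hence `H_t = Ṽ x` for some `x`, and `Ṽ Ṽᵀ H_t` is close to `H_t`.

The coefficients `Ṽᵀ H_t` are estimated by medians of means: Chebyshev's inequality makes each mean
fail with probability at most `1 / 16`, so that a median of `N` of them fails with probability at
most `2⁻ᴺ` (`median_deviation_le`). Together these give `‖Ĥ_t - H_t‖ ≤ (ε / 2) ‖H_t‖`
(`vecNorm_mulVec_sub_le`), and normalizing at most doubles the relative error (`tvDist_lsDist_le`).
-/

open scoped Matrix

noncomputable section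

namespace ConicalHull

/-! ### Finite products of weights -/

theorem sum_fin_succ_fun {ι : Type*} [Fintype ι] {N : ℕ} (f : (Fin (N + 1) → ι) → ℝ) :
    ∑ c, f c = ∑ i, ∑ c : Fin N → ι, f (Fin.cons i c) := by
  rw [← (Fin.consEquiv fun _ => ι).sum_comp, Fintype.sum_prod_type]
  rfl

theorem sum_prod_weights {κ ι : Type*} [Fintype κ] [DecidableEq κ] [Fintype ι] (p : ι → ℝ) :
    ∑ c : κ → ι, ∏ t, p (c t) = (∑ i, p i) ^ Fintype.card κ := by
  rw [← Fintype.prod_sum fun (_ : κ) i => p i]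
  simp

/-! ### Concentration of sums of independent vectors -/

theorem cosh_sqrt_le_chord {x y θ : ℝ} (hx : 0 ≤ x) (hy : 0 ≤ y) (h0 : 0 ≤ θ) (h1 : θ ≤ 1) :
    Real.cosh √(θ * x + (1 - θ) * y) ≤ θ * Real.cosh √x + (1 - θ) * Real.cosh √y := by
  have h2 : 0 ≤ 1 - θ := by linarith
  have key : ∀ z : ℝ, 0 ≤ z →
      HasSum (fun j : ℕ => z ^ j / ((2 * j).factorial : ℝ)) (Real.cosh √z) := by
    intro z hz
    have h := Real.hasSum_cosh √z
    simpa only [pow_mul, Real.sq_sqrt hz] using h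
  refine hasSum_le (fun j => ?_) (key _ (by positivity))
    (((key x hx).mul_left θ).add ((key y hy).mul_left (1 - θ)))
  have hc := (convexOn_pow j (𝕜 := ℝ)).2 (Set.mem_Ici.2 hx) (Set.mem_Ici.2 hy) h0 h2 (by ring)
  simp only [smul_eq_mul] at hc
  calc _ ≤ (θ * x ^ j + (1 - θ) * y ^ j) / ((2 * j).factorial : ℝ) := by gcongr
    _ = _ := by ring

/-- A bound for `cosh √(A² + b² + 2 t)` that is affine in `t`: the chord of this convex function
over `[-A b, A b]`, at whose ends the square root is `A ± b`. -/
theorem cosh_sqrt_le_affine {A b t : ℝ} (hA : 0 ≤ A) (hb : 0 ≤ b) (ht : |t| ≤ A * b) :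
    Real.cosh √(A ^ 2 + b ^ 2 + 2 * t) ≤
      Real.cosh A * Real.cosh b + Real.sinh A * Real.sinh b / (A * b) * t := by
  obtain ⟨ht1, ht2⟩ := abs_le.1 ht
  rcases eq_or_ne (A * b) 0 with h | h
  · have ht0 : t = 0 := by rw [h] at ht1 ht2; linarith
    subst ht0
    rcases mul_eq_zero.1 h with h | h <;> simp [h, Real.sqrt_sq hA, Real.sqrt_sq hb]
  · have hpos : 0 < A * b := lt_of_le_of_ne (by positivity) (Ne.symm h)
    have hc := cosh_sqrt_le_chord (sq_nonneg (A + b)) (sq_nonneg (A - b))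
      (θ := (A * b + t) / (2 * (A * b))) (div_nonneg (by linarith) (by linarith))
      ((div_le_one (by linarith)).2 (by linarith))
    have e : (A * b + t) / (2 * (A * b)) * (A + b) ^ 2 +
        (1 - (A * b + t) / (2 * (A * b))) * (A - b) ^ 2 = A ^ 2 + b ^ 2 + 2 * t := by
      have hA0 : A ≠ 0 := left_ne_zero_of_mul h
      have hb0 : b ≠ 0 := right_ne_zero_of_mul h
      field_simp
      ring
    rw [e, Real.sqrt_sq_eq_abs, Real.sqrt_sq_eq_abs, Real.cosh_abs, Real.cosh_abs, Real.cosh_add,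
      Real.cosh_sub] at hc
    refine hc.trans (le_of_eq ?_)
    have hA0 : A ≠ 0 := left_ne_zero_of_mul h
    have hb0 : b ≠ 0 := right_ne_zero_of_mul h
    field_simp
    ring

section Concentration

variable {E : Type*} [NormedAddCommGroup E] [InnerProductSpace ℝ E]

/-- One step of the exponential moment bound: adding a centred vector of norm at most `b` raises
the expectation of `cosh ‖·‖` by a factor of at most `cosh b`. As `‖x + X‖² ≤ ‖x‖² + b² + 2⟨x, X⟩`,
the affine bound `cosh_sqrt_le_affine` applies, and its linear part has expectation zero. -/
theorem sum_cosh_norm_add_le {ι : Type*} [Fintype ι] (p : ι → ℝ) (hp : ∀ i, 0 ≤ p i)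
    (hp1 : ∑ i, p i = 1) (X : ι → E) (hX : ∑ i, p i • X i = 0) {b : ℝ} (hb : 0 ≤ b)
    (hXb : ∀ i, p i ≠ 0 → ‖X i‖ ≤ b) (x : E) :
    ∑ i, p i * Real.cosh ‖x + X i‖ ≤ Real.cosh b * Real.cosh ‖x‖ := by
  set κ := Real.sinh ‖x‖ * Real.sinh b / (‖x‖ * b)
  have hle : ∀ i, p i * Real.cosh ‖x + X i‖ ≤
      p i * (Real.cosh ‖x‖ * Real.cosh b + κ * inner ℝ x (X i)) := by
    intro i
    rcases eq_or_ne (p i) 0 with h | h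
    · simp [h]
    refine mul_le_mul_of_nonneg_left ?_ (hp i)
    have hi := hXb i h
    refine le_trans ?_ (cosh_sqrt_le_affine (norm_nonneg x) hb
      ((abs_real_inner_le_norm _ _).trans (by gcongr)))
    rw [Real.cosh_le_cosh, abs_of_nonneg (norm_nonneg _), abs_of_nonneg (Real.sqrt_nonneg _)]
    apply Real.le_sqrt_of_sq_le
    rw [norm_add_sq_real]
    have : ‖X i‖ ^ 2 ≤ b ^ 2 := by gcongr
    linarith
  refine (Finset.sum_le_sum fun i _ => hle i).trans (le_of_eq ?_)
  have h0 : ∑ i, p i * inner ℝ x (X i) = 0 := by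
    simp_rw [← real_inner_smul_right, ← inner_sum, hX, inner_zero_right]
  calc _ = (∑ i, p i) * (Real.cosh ‖x‖ * Real.cosh b) + κ * ∑ i, p i * inner ℝ x (X i) := by
        rw [Finset.sum_mul, Finset.mul_sum, ← Finset.sum_add_distrib]
        exact Finset.sum_congr rfl fun i _ => by ring
    _ = _ := by rw [h0, hp1]; ring

theorem sum_prod_cosh_norm_le {ι : Type*} [Fintype ι] (p : ι → ℝ) (hp : ∀ i, 0 ≤ p i)
    (hp1 : ∑ i, p i = 1) (X : ι → E) (hX : ∑ i, p i • X i = 0) {b : ℝ} (hb : 0 ≤ b)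
    (hXb : ∀ i, p i ≠ 0 → ‖X i‖ ≤ b) (N : ℕ) (x : E) :
    ∑ c : Fin N → ι, (∏ t, p (c t)) * Real.cosh ‖x + ∑ t, X (c t)‖ ≤
      Real.cosh b ^ N * Real.cosh ‖x‖ := by
  induction N generalizing x with
  | zero => simp
  | succ N ih =>
    rw [sum_fin_succ_fun]
    simp only [Fin.prod_univ_succ, Fin.sum_univ_succ, Fin.cons_zero, Fin.cons_succ, ← add_assoc]
    calc _ = ∑ i, p i * ∑ c : Fin N → ι, (∏ t, p (c t)) *
          Real.cosh ‖x + X i + ∑ t, X (c t)‖ := by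
          refine Finset.sum_congr rfl fun i _ => ?_
          rw [Finset.mul_sum]
          exact Finset.sum_congr rfl fun c _ => by ring
      _ ≤ ∑ i, p i * (Real.cosh b ^ N * Real.cosh ‖x + X i‖) := by
          gcongr with i
          · exact hp i
          · exact ih _
      _ = Real.cosh b ^ N * ∑ i, p i * Real.cosh ‖x + X i‖ := by
          rw [Finset.mul_sum]
          exact Finset.sum_congr rfl fun c _ => by ring
      _ ≤ Real.cosh b ^ N * (Real.cosh b * Real.cosh ‖x‖) := by
          gcongr
          exact sum_cosh_norm_add_le p hp hp1 X hX hb hXb x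
      _ = _ := by ring

open Classical in
/-- Hoeffding's inequality for independent centred random vectors of norm at most `b` in an inner
product space, with a bound that does not depend on the dimension (Pinelis). -/
theorem norm_sum_concentration {ι : Type*} [Fintype ι] (p : ι → ℝ) (hp : ∀ i, 0 ≤ p i)
    (hp1 : ∑ i, p i = 1) (X : ι → E) (hX : ∑ i, p i • X i = 0) {b : ℝ} (hb : 0 < b)
    (hXb : ∀ i, p i ≠ 0 → ‖X i‖ ≤ b) {N : ℕ} (hN : 0 < N) {r : ℝ} (hr : 0 ≤ r) :
    1 - 2 * Real.exp (-(r ^ 2 / (2 * N * b ^ 2))) ≤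
      ∑ c : Fin N → ι, if ‖∑ t, X (c t)‖ ≤ r then ∏ t, p (c t) else 0 := by
  have hN' : (0 : ℝ) < N := by exact_mod_cast hN
  -- The choice of `L` that minimizes `exp (N L² b² / 2 - L r)`.
  set L := r / (N * b ^ 2) with hL
  have hL0 : 0 ≤ L := by positivity
  have hmom := sum_prod_cosh_norm_le p hp hp1 (fun i => L • X i)
    (by simp_rw [smul_comm _ L, ← Finset.smul_sum, hX, smul_zero]) (b := L * b) (by positivity)
    (fun i hi => by
      rw [norm_smul, Real.norm_of_nonneg hL0]; exact mul_le_mul_of_nonneg_left (hXb i hi) hL0) N 0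
  simp only [zero_add, norm_zero, Real.cosh_zero, mul_one, ← Finset.smul_sum, norm_smul,
    Real.norm_of_nonneg hL0] at hmom
  have hcosh : Real.cosh (L * b) ^ N ≤ Real.exp (N * ((L * b) ^ 2 / 2)) := by
    rw [Real.exp_nat_mul]
    exact pow_le_pow_left₀ (Real.cosh_pos _).le (Real.cosh_le_exp_half_sq _) N
  have htot : ∑ c : Fin N → ι, ∏ t, p (c t) = 1 := by rw [sum_prod_weights, hp1, one_pow]
  have hpt : ∀ c : Fin N → ι, (∏ t, p (c t)) -
      2 * Real.exp (-(L * r)) * ((∏ t, p (c t)) * Real.cosh (L * ‖∑ t, X (c t)‖)) ≤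
      if ‖∑ t, X (c t)‖ ≤ r then ∏ t, p (c t) else 0 := by
    intro c
    have h0 : 0 ≤ ∏ t, p (c t) := Finset.prod_nonneg fun t _ => hp _
    split_ifs with h
    · have := (Real.cosh_pos (L * ‖∑ t, X (c t)‖)).le
      have : 0 ≤ 2 * Real.exp (-(L * r)) * ((∏ t, p (c t)) * Real.cosh (L * ‖∑ t, X (c t)‖)) := by
        positivity
      linarith
    · have h1 : Real.exp (L * r) ≤ 2 * Real.cosh (L * ‖∑ t, X (c t)‖) := by
        have h2 : Real.exp (L * r) ≤ Real.exp (L * ‖∑ t, X (c t)‖) := by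
          apply Real.exp_le_exp.2
          exact mul_le_mul_of_nonneg_left (not_le.1 h).le hL0
        rw [Real.cosh_eq]
        have := Real.exp_pos (-(L * ‖∑ t, X (c t)‖))
        linarith
      have h3 : 1 ≤ Real.exp (-(L * r)) * (2 * Real.cosh (L * ‖∑ t, X (c t)‖)) := by
        calc (1 : ℝ) = Real.exp (-(L * r)) * Real.exp (L * r) := by rw [← Real.exp_add]; simp
          _ ≤ _ := by gcongr
      have := mul_le_mul_of_nonneg_left h3 h0
      linarith
  refine le_trans ?_ (Finset.sum_le_sum fun c _ => hpt c)
  rw [Finset.sum_sub_distrib, htot, ← Finset.mul_sum]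
  have hfin : 2 * Real.exp (-(L * r)) * ∑ c : Fin N → ι, (∏ t, p (c t)) *
      Real.cosh (L * ‖∑ t, X (c t)‖) ≤ 2 * Real.exp (-(r ^ 2 / (2 * N * b ^ 2))) := by
    calc _ ≤ 2 * Real.exp (-(L * r)) * Real.exp (N * ((L * b) ^ 2 / 2)) := by
          gcongr; exact hmom.trans hcosh
      _ = _ := by
          rw [mul_assoc, ← Real.exp_add, hL]
          congr 2
          field_simp
          ring
  linarith

end Concentration

/-! ### The median of means -/

theorem sum_prod_sq_eq {ι : Type*} [Fintype ι] (p : ι → ℝ) (hp1 : ∑ i, p i = 1) (Y : ι → ℝ)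
    (hY : ∑ i, p i * Y i = 0) (N : ℕ) (y : ℝ) :
    ∑ c : Fin N → ι, (∏ t, p (c t)) * (y + ∑ t, Y (c t)) ^ 2 =
      y ^ 2 + N * ∑ i, p i * Y i ^ 2 := by
  induction N generalizing y with
  | zero => simp
  | succ N ih =>
    rw [sum_fin_succ_fun]
    simp only [Fin.prod_univ_succ, Fin.sum_univ_succ, Fin.cons_zero, Fin.cons_succ, ← add_assoc,
      mul_assoc, ← Finset.mul_sum, ih]
    have expand : ∀ v : ℝ, ∑ i, p i * ((y + Y i) ^ 2 + v) =
        (∑ i, p i) * (y ^ 2 + v) + 2 * y * (∑ i, p i * Y i) + ∑ i, p i * Y i ^ 2 := by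
      intro v
      rw [Finset.sum_mul, Finset.mul_sum, ← Finset.sum_add_distrib, ← Finset.sum_add_distrib]
      exact Finset.sum_congr rfl fun i _ => by ring
    rw [expand, hp1, hY]
    push_cast
    ring

open Classical in
/-- Chebyshev's inequality for the mean of `N` independent samples. -/
theorem mean_deviation_le {ι : Type*} [Fintype ι] (p : ι → ℝ) (hp : ∀ i, 0 ≤ p i)
    (hp1 : ∑ i, p i = 1) (Z : ι → ℝ) {N : ℕ} (hN : 0 < N) {e : ℝ} (he : 0 < e) :
    ∑ c : Fin N → ι, (if e < |(∑ t, Z (c t)) / N - ∑ i, p i * Z i| then ∏ t, p (c t) else 0) ≤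
      (∑ i, p i * Z i ^ 2) / (N * e ^ 2) := by
  have hN' : (0 : ℝ) < N := by exact_mod_cast hN
  set q := ∑ i, p i * Z i with hq
  have hvar : ∑ i, p i * (Z i - q) ^ 2 ≤ ∑ i, p i * Z i ^ 2 := by
    have expand : ∀ u : ℝ, ∑ i, p i * (Z i - u) ^ 2 =
        (∑ i, p i * Z i ^ 2) - 2 * u * (∑ i, p i * Z i) + u ^ 2 * ∑ i, p i := by
      intro u
      rw [Finset.mul_sum, Finset.mul_sum, ← Finset.sum_sub_distrib, ← Finset.sum_add_distrib]
      exact Finset.sum_congr rfl fun i _ => by ring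
    rw [expand, hp1, ← hq]
    nlinarith [sq_nonneg q]
  have hsq := sum_prod_sq_eq p hp1 (fun i => Z i - q)
    (by simp_rw [mul_sub]; rw [Finset.sum_sub_distrib, ← Finset.sum_mul, hp1, ← hq]; ring) N 0
  have hpt : ∀ c : Fin N → ι,
      (if e < |(∑ t, Z (c t)) / N - q| then ∏ t, p (c t) else 0) ≤
      (∏ t, p (c t)) * (0 + ∑ t, (Z (c t) - q)) ^ 2 / (N * e) ^ 2 := by
    intro c
    have h0 : 0 ≤ ∏ t, p (c t) := Finset.prod_nonneg fun t _ => hp _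
    split_ifs with h
    · rw [le_div_iff₀ (by positivity)]
      refine mul_le_mul_of_nonneg_left ?_ h0
      rw [zero_add, Finset.sum_sub_distrib, Finset.sum_const, Finset.card_univ, Fintype.card_fin,
        nsmul_eq_mul]
      have e1 : ∑ t, Z (c t) - N * q = N * ((∑ t, Z (c t)) / N - q) := by field_simp
      rw [e1, mul_pow, mul_pow, ← sq_abs ((∑ t, Z (c t)) / N - q)]
      gcongr
    · positivity
  refine (Finset.sum_le_sum fun c _ => hpt c).trans ?_
  rw [← Finset.sum_div, hsq, div_le_div_iff₀ (by positivity) (by positivity)]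
  have : 0 ≤ (N : ℝ) ^ 2 * e ^ 2 := by positivity
  nlinarith [mul_le_mul_of_nonneg_left hvar this]

theorem abs_median_sub_le {N : ℕ} (x : Fin N → ℝ) (hN : 0 < N) {q e : ℝ}
    (h : 2 * (Finset.univ.filter fun a => e < |x a - q|).card < N) : |median x - q| ≤ e := by
  have hmono := Tuple.monotone_sort x
  set S := Finset.univ.filter fun a => e < |x a - q| with hS
  have hup : ∀ i : Fin N, N ≤ 2 * (N - i.1) → x (Tuple.sort x i) ≤ q + e := by
    intro i hi
    by_contra hcon
    push Not at hcon
    have : (Finset.Ici i).map (Tuple.sort x).toEmbedding ⊆ S := by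
      intro a ha
      obtain ⟨j, hj, rfl⟩ := Finset.mem_map.1 ha
      have := hmono (Finset.mem_Ici.1 hj)
      simp only [Function.comp] at this
      simp only [hS, Finset.mem_filter, Finset.mem_univ, true_and, Equiv.coe_toEmbedding]
      exact lt_abs.2 (Or.inl (by linarith))
    have := Finset.card_le_card this
    rw [Finset.card_map, Fin.card_Ici] at this
    omega
  have hdown : ∀ i : Fin N, N ≤ 2 * (i.1 + 1) → q - e ≤ x (Tuple.sort x i) := by
    intro i hi
    by_contra hcon
    push Not at hcon
    have : (Finset.Iic i).map (Tuple.sort x).toEmbedding ⊆ S := by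
      intro a ha
      obtain ⟨j, hj, rfl⟩ := Finset.mem_map.1 ha
      have := hmono (Finset.mem_Iic.1 hj)
      simp only [Function.comp] at this
      simp only [hS, Finset.mem_filter, Finset.mem_univ, true_and, Equiv.coe_toEmbedding]
      exact lt_abs.2 (Or.inr (by linarith))
    have := Finset.card_le_card this
    rw [Finset.card_map, Fin.card_Iic] at this
    omega
  have h1 := hup ⟨(N - 1) / 2, by omega⟩ (by simp only; omega)
  have h2 := hup ⟨N / 2, by omega⟩ (by simp only; omega)
  have h3 := hdown ⟨(N - 1) / 2, by omega⟩ (by simp only; omega)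
  have h4 := hdown ⟨N / 2, by omega⟩ (by simp only; omega)
  rw [median, dif_pos hN, abs_le]
  constructor <;> linarith

open Classical in
/-- The median of `N` independent estimates, each of which fails with probability at most `1/16`,
fails with probability at most `2⁻ᴺ`. If it fails then at least half of the estimates do, so that
the product over the estimates of `4` for a failure and `1/4` for a success is at least `1`. The
expectation of each factor is at most `1/2`. -/
theorem median_deviation_le {β : Type*} [Fintype β] (w : β → ℝ) (hw : ∀ i, 0 ≤ w i)
    (hw1 : ∑ i, w i = 1) (f : β → ℝ) {q e : ℝ}
    (hf : ∑ i, (if e < |f i - q| then w i else 0) ≤ 1 / 16) {N : ℕ} (hN : 0 < N) :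
    ∑ z : Fin N → β, (if e < |median (fun a => f (z a)) - q| then ∏ a, w (z a) else 0) ≤
      (1 / 2) ^ N := by
  let g : β → ℝ := fun i => if e < |f i - q| then 4 else 1 / 4
  have hpt : ∀ z : Fin N → β,
      (if e < |median (fun a => f (z a)) - q| then ∏ a, w (z a) else 0) ≤
        ∏ a, (w (z a) * g (z a)) := by
    intro z
    have h0 : 0 ≤ ∏ a, w (z a) := Finset.prod_nonneg fun t _ => hw _
    have hg0 : ∀ i, 0 ≤ g i := fun i => by simp only [g]; split_ifs <;> norm_num
    rw [Finset.prod_mul_distrib]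
    split_ifs with h
    · refine le_mul_of_one_le_right h0 ?_
      have hcard : N ≤ 2 * (Finset.univ.filter fun a => e < |f (z a) - q|).card := by
        by_contra hc
        exact absurd (abs_median_sub_le (fun a => f (z a)) hN (not_le.1 hc)) (not_le.2 h)
      have hle := Finset.card_filter_add_card_filter_not (s := (Finset.univ : Finset (Fin N)))
        (fun a => e < |f (z a) - q|)
      rw [Finset.card_univ, Fintype.card_fin] at hle
      simp only [g, Finset.prod_ite, Finset.prod_const]
      set u := (Finset.univ.filter fun a => e < |f (z a) - q|).card
      set v := (Finset.univ.filter fun a => ¬ e < |f (z a) - q|).card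
      have huv : v ≤ u := by omega
      calc (1 : ℝ) = 4 ^ v * (1 / 4) ^ v := by rw [← mul_pow]; norm_num
        _ ≤ 4 ^ u * (1 / 4) ^ v := by gcongr; norm_num
    · exact mul_nonneg h0 (Finset.prod_nonneg fun t _ => hg0 _)
  refine (Finset.sum_le_sum fun z _ => hpt z).trans ?_
  rw [sum_prod_weights fun i => w i * g i, Fintype.card_fin]
  refine pow_le_pow_left₀ (Finset.sum_nonneg fun i _ => mul_nonneg (hw i) ?_) ?_ N
  · simp only [g]; split_ifs <;> norm_num
  · have : ∀ i, w i * g i = 15 / 4 * (if e < |f i - q| then w i else 0) + 1 / 4 * w i := by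
      intro i
      simp only [g]
      split_ifs <;> ring
    simp_rw [this]
    rw [Finset.sum_add_distrib, ← Finset.mul_sum, ← Finset.mul_sum, hw1]
    linarith

/-! ### Euclidean, Frobenius and spectral norms -/

section Norms

variable {ι : Type*} [Fintype ι]

theorem vecNorm_nonneg (v : ι → ℝ) : 0 ≤ vecNorm v := norm_nonneg _

theorem vecNorm_sq (v : ι → ℝ) : vecNorm v ^ 2 = ∑ i, v i ^ 2 := by
  rw [vecNorm, EuclideanSpace.real_norm_sq_eq]

theorem vecNorm_sq_eq_dotProduct (v : ι → ℝ) : vecNorm v ^ 2 = v ⬝ᵥ v := by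
  rw [vecNorm_sq, dotProduct]
  exact Finset.sum_congr rfl fun i _ => sq _

theorem vecNorm_eq_zero {v : ι → ℝ} : vecNorm v = 0 ↔ v = 0 := by
  rw [vecNorm, norm_eq_zero, WithLp.toLp_eq_zero]

theorem vecNorm_pos {v : ι → ℝ} (hv : v ≠ 0) : 0 < vecNorm v :=
  lt_of_le_of_ne (vecNorm_nonneg v) fun h => hv (vecNorm_eq_zero.1 h.symm)

theorem vecNorm_add_le (v w : ι → ℝ) : vecNorm (v + w) ≤ vecNorm v + vecNorm w := by
  simpa only [vecNorm, WithLp.toLp_add] using norm_add_le (WithLp.toLp 2 v) (WithLp.toLp 2 w)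

theorem abs_vecNorm_sub_vecNorm_le (v w : ι → ℝ) : |vecNorm v - vecNorm w| ≤ vecNorm (v - w) := by
  simpa only [vecNorm, WithLp.toLp_sub] using
    abs_norm_sub_norm_le (WithLp.toLp 2 v) (WithLp.toLp 2 w)

theorem vecNorm_smul (a : ℝ) (v : ι → ℝ) : vecNorm (a • v) = |a| * vecNorm v := by
  rw [vecNorm, WithLp.toLp_smul, norm_smul, Real.norm_eq_abs, vecNorm]

theorem abs_dotProduct_le (v w : ι → ℝ) : |v ⬝ᵥ w| ≤ vecNorm v * vecNorm w := by
  have h := Finset.sum_mul_sq_le_sq_mul_sq Finset.univ v w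
  rw [← vecNorm_sq, ← vecNorm_sq, ← mul_pow] at h
  exact abs_le_of_sq_le_sq h (mul_nonneg (vecNorm_nonneg v) (vecNorm_nonneg w))

end Norms

theorem mulVec_dotProduct_mulVec {a b c : Type*} [Fintype a] [Fintype b] [Fintype c]
    (A : Matrix a b ℝ) (B : Matrix a c ℝ) (x : b → ℝ) (y : c → ℝ) :
    (A *ᵥ x) ⬝ᵥ (B *ᵥ y) = x ⬝ᵥ ((Aᵀ * B) *ᵥ y) := by
  rw [← Matrix.mulVec_mulVec, Matrix.mulVec_transpose, dotProduct_comm x,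
    ← Matrix.dotProduct_mulVec, dotProduct_comm]

theorem frobNorm_nonneg {n m : ℕ} (A : Matrix (Fin n) (Fin m) ℝ) : 0 ≤ frobNorm A := by
  rw [frobNorm, Matrix.frobenius_norm_def]
  positivity

theorem frobNorm_sq {n m : ℕ} (A : Matrix (Fin n) (Fin m) ℝ) :
    frobNorm A ^ 2 = ∑ i, ∑ j, A i j ^ 2 := by
  rw [frobNorm, Matrix.frobenius_norm_def, ← Real.rpow_natCast, ← Real.rpow_mul (by positivity)]
  norm_num

theorem frobNorm_transpose {n m : ℕ} (A : Matrix (Fin n) (Fin m) ℝ) :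
    frobNorm Aᵀ = frobNorm A := by
  refine (pow_left_inj₀ (frobNorm_nonneg _) (frobNorm_nonneg _) two_ne_zero).1 ?_
  rw [frobNorm_sq, frobNorm_sq, Finset.sum_comm]
  rfl

theorem vecNorm_mulVec_le_frobNorm {n m : ℕ} (A : Matrix (Fin n) (Fin m) ℝ) (x : Fin m → ℝ) :
    vecNorm (A *ᵥ x) ≤ frobNorm A * vecNorm x := by
  refine le_of_sq_le_sq ?_ (mul_nonneg (frobNorm_nonneg A) (vecNorm_nonneg x))
  rw [mul_pow, vecNorm_sq, frobNorm_sq, vecNorm_sq, Finset.sum_mul]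
  exact Finset.sum_le_sum fun i _ => Finset.sum_mul_sq_le_sq_mul_sq Finset.univ (A i) x

theorem specNorm_nonneg {n m : ℕ} (A : Matrix (Fin n) (Fin m) ℝ) : 0 ≤ specNorm A := by
  rw [specNorm, Matrix.l2_opNorm_def]
  exact norm_nonneg _

theorem vecNorm_mulVec_le_specNorm {n m : ℕ} (A : Matrix (Fin n) (Fin m) ℝ) (x : Fin m → ℝ) :
    vecNorm (A *ᵥ x) ≤ specNorm A * vecNorm x :=
  Matrix.l2_opNorm_mulVec A (WithLp.toLp 2 x)

theorem specNorm_le_frobNorm {n m : ℕ} (A : Matrix (Fin n) (Fin m) ℝ) :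
    specNorm A ≤ frobNorm A := by
  rw [specNorm, Matrix.l2_opNorm_def]
  exact ContinuousLinearMap.opNorm_le_bound _ (frobNorm_nonneg A)
    fun x => vecNorm_mulVec_le_frobNorm A x.ofLp

/-! ### Singular values of a rectangular matrix -/

theorem finrank_range_toEuclideanLin {n m : ℕ} (H : Matrix (Fin n) (Fin m) ℝ) :
    Module.finrank ℝ (Matrix.toEuclideanLin H).range = H.rank := by
  rw [Matrix.toEuclideanLin_eq_toLin_orthonormal, ← Matrix.rank_eq_finrank_range_toLin]

theorem rank_pos_of_mulVec_ne_zero {n m : ℕ} {H : Matrix (Fin n) (Fin m) ℝ} {x : Fin m → ℝ}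
    (h : H *ᵥ x ≠ 0) : 0 < H.rank := by
  rw [Nat.pos_iff_ne_zero]
  intro h0
  rw [Matrix.rank, Submodule.finrank_eq_zero] at h0
  exact h ((Submodule.mem_bot ℝ).1 (h0 ▸ LinearMap.mem_range_self H.mulVecLin x))

theorem sigmaMin_pos {n m : ℕ} {H : Matrix (Fin n) (Fin m) ℝ} (h : 0 < H.rank) :
    0 < sigmaMin H := by
  rw [sigmaMin, LinearMap.singularValues_pos_iff_lt_finrank_range, finrank_range_toEuclideanLin]
  omega

/-- `H x` lies in the column space of `H`, on which `Hᵀ` expands lengths by at least the smallest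
nonzero singular value. -/
theorem sigmaMin_sq_mul_le {n m : ℕ} (H : Matrix (Fin n) (Fin m) ℝ) (x : Fin m → ℝ) :
    sigmaMin H ^ 2 * vecNorm (H *ᵥ x) ^ 2 ≤ vecNorm (Hᵀ *ᵥ (H *ᵥ x)) ^ 2 := by
  set T := Matrix.toEuclideanLin H
  set y : EuclideanSpace ℝ (Fin m) := WithLp.toLp 2 x
  set b := T.isSymmetric_adjoint_comp_self.eigenvectorBasis rfl
  set G := T.adjoint ∘ₗ T with hG
  have hTy : vecNorm (H *ᵥ x) = ‖T y‖ := rfl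
  have hadj : vecNorm (Hᵀ *ᵥ (H *ᵥ x)) = ‖G y‖ := by
    rw [hG, LinearMap.comp_apply, ← Matrix.toEuclideanLin_conjTranspose_eq_adjoint,
      Matrix.conjTranspose_eq_transpose_of_trivial]
    rfl
  have hcoef : ∀ i, inner ℝ (b i) (G y) = T.singularValues i ^ 2 * inner ℝ (b i) y := by
    intro i
    rw [← T.isSymmetric_adjoint_comp_self (b i) y,
      T.isSymmetric_adjoint_comp_self.apply_eigenvectorBasis rfl i, inner_smul_left,
      T.sq_singularValues_fin rfl]
    rfl
  have h1 : ‖G y‖ ^ 2 = ∑ i : Fin _, (T.singularValues i ^ 2 * inner ℝ (b i) y) ^ 2 := by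
    rw [← b.sum_sq_norm_inner_right]
    exact Finset.sum_congr rfl fun i _ => by rw [hcoef, Real.norm_eq_abs, sq_abs]
  have h2 : ‖T y‖ ^ 2 = ∑ i : Fin _, T.singularValues i ^ 2 * inner ℝ (b i) y ^ 2 := by
    rw [← real_inner_self_eq_norm_sq, ← LinearMap.adjoint_inner_right, ← LinearMap.comp_apply,
      ← b.sum_inner_mul_inner y]
    exact Finset.sum_congr rfl fun i _ => by rw [hcoef, real_inner_comm]; ring
  rw [hTy, hadj, h1, h2, Finset.mul_sum]
  refine Finset.sum_le_sum fun i _ => ?_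
  -- The `i`-th singular value is either zero or at least `sigmaMin H`.
  rcases lt_or_ge (i : ℕ) H.rank with hi | hi
  · have hs : sigmaMin H ≤ T.singularValues i := T.singularValues_antitone (by omega)
    have hs0 : 0 ≤ sigmaMin H := T.singularValues_nonneg _
    have : sigmaMin H ^ 2 ≤ T.singularValues i ^ 2 := by gcongr
    have h3 := mul_le_mul_of_nonneg_right this
      (show 0 ≤ T.singularValues i ^ 2 * inner ℝ (b i) y ^ 2 by positivity)
    linarith
  · have : T.singularValues i = 0 := by
      rw [T.singularValues_eq_zero_iff_le_finrank_range, finrank_range_toEuclideanLin]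
      exact hi
    simp [this]

theorem frobNorm_sq_le_rank_mul {n m : ℕ} (H : Matrix (Fin n) (Fin m) ℝ) :
    frobNorm H ^ 2 ≤ H.rank * specNorm H ^ 2 := by
  set T := Matrix.toEuclideanLin H
  have hS0 : 0 ≤ specNorm H := specNorm_nonneg H
  have htr : frobNorm H ^ 2 =
      ∑ i : Fin (Module.finrank ℝ (EuclideanSpace ℝ (Fin m))), T.singularValues i ^ 2 := by
    simp_rw [T.sq_singularValues_fin rfl]
    have h1 := T.isSymmetric_adjoint_comp_self.trace_eq_sum_eigenvalues rfl
    simp only [RCLike.ofReal_real_eq_id, id] at h1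
    rw [← h1, ← Matrix.toEuclideanLin_conjTranspose_eq_adjoint,
      Matrix.conjTranspose_eq_transpose_of_trivial]
    have h2 : Matrix.toEuclideanLin Hᵀ ∘ₗ T = Matrix.toEuclideanLin (Hᵀ * H) := by
      ext x i
      simp [T]
    rw [h2, Matrix.toEuclideanLin_eq_toLin_orthonormal, Matrix.trace_toLin_eq, frobNorm_sq,
      Finset.sum_comm, Matrix.trace]
    exact Finset.sum_congr rfl fun j _ => by
      simp [Matrix.mul_apply, sq]
  have hle : ∀ i : ℕ, T.singularValues i ≤ specNorm H := by
    intro i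
    rcases lt_or_ge i (Module.finrank ℝ (EuclideanSpace ℝ (Fin m))) with hi | hi
    · set b := T.isSymmetric_adjoint_comp_self.eigenvectorBasis rfl
      refine le_of_sq_le_sq ?_ hS0
      have hb : ‖b ⟨i, hi⟩‖ = 1 := b.orthonormal.1 _
      have h1 : T.singularValues i ^ 2 = ‖T (b ⟨i, hi⟩)‖ ^ 2 := by
        rw [T.sq_singularValues_of_lt rfl hi, ← real_inner_self_eq_norm_sq,
          ← LinearMap.adjoint_inner_right, ← LinearMap.comp_apply,
          T.isSymmetric_adjoint_comp_self.apply_eigenvectorBasis rfl, inner_smul_right,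
          real_inner_self_eq_norm_sq, hb]
        simp
      rw [h1]
      have h2 := vecNorm_mulVec_le_specNorm H (b ⟨i, hi⟩).ofLp
      have h3 : vecNorm (b ⟨i, hi⟩).ofLp = 1 := hb
      rw [h3, mul_one] at h2
      exact pow_le_pow_left₀ (norm_nonneg _) h2 2
    · rw [T.singularValues_of_finrank_le hi]
      exact hS0
  have hzero : ∀ i : ℕ, H.rank ≤ i → T.singularValues i = 0 := by
    intro i hi
    rw [T.singularValues_eq_zero_iff_le_finrank_range, finrank_range_toEuclideanLin]
    exact hi
  rw [htr, Fin.sum_univ_eq_sum_range fun i => T.singularValues i ^ 2]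
  rw [← Finset.sum_filter_of_ne (p := fun i => i < H.rank) fun i _ hi => by
    by_contra hc
    exact hi (by rw [hzero i (not_lt.1 hc)]; simp)]
  refine (Finset.sum_le_card_nsmul _ _ (specNorm H ^ 2) fun i _ =>
    pow_le_pow_left₀ (T.singularValues_nonneg i) (hle i) 2).trans ?_
  rw [nsmul_eq_mul]
  gcongr
  calc _ ≤ (Finset.range H.rank).card := Finset.card_le_card fun i hi => by
        simpa using (Finset.mem_filter.1 hi).2
    _ = _ := Finset.card_range _

theorem sigmaMin_le_specNorm {n m : ℕ} {H : Matrix (Fin n) (Fin m) ℝ} {x : Fin m → ℝ}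
    (hx : H *ᵥ x ≠ 0) : sigmaMin H ≤ specNorm H := by
  have h1 := sigmaMin_sq_mul_le H x
  have h0 := vecNorm_pos hx
  -- `Hᵀ` is bounded by the spectral norm of `H`: `‖Hᵀ y‖² = ⟨y, H Hᵀ y⟩ ≤ ‖y‖ ‖H‖ ‖Hᵀ y‖`.
  have h2 : vecNorm (Hᵀ *ᵥ (H *ᵥ x)) ≤ specNorm H * vecNorm (H *ᵥ x) := by
    set y := H *ᵥ x
    have h3 : vecNorm (Hᵀ *ᵥ y) ^ 2 ≤ vecNorm y * (specNorm H * vecNorm (Hᵀ *ᵥ y)) := by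
      rw [vecNorm_sq_eq_dotProduct, mulVec_dotProduct_mulVec, Matrix.transpose_transpose,
        ← Matrix.mulVec_mulVec]
      exact (le_abs_self _).trans ((abs_dotProduct_le _ _).trans
        (mul_le_mul_of_nonneg_left (vecNorm_mulVec_le_specNorm _ _) (vecNorm_nonneg _)))
    rcases (vecNorm_nonneg (Hᵀ *ᵥ y)).eq_or_lt with h | h
    · rw [← h]; exact mul_nonneg (specNorm_nonneg H) (vecNorm_nonneg _)
    · refine le_of_mul_le_mul_right ?_ h
      linarith
  rw [← mul_pow] at h1
  have h4 := (le_of_sq_le_sq h1 (vecNorm_nonneg _)).trans h2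
  exact le_of_mul_le_mul_right h4 h0

/-! ### Perturbation of the singular value decomposition -/

namespace SVD

variable {s : ℕ} {C : Matrix (Fin s) (Fin s) ℝ} (D : SVD C)

theorem transpose_W_mul_W : D.Wᵀ * D.W = 1 :=
  (Matrix.mem_orthogonalGroup_iff' (Fin s) ℝ).1 D.W_orthogonal

theorem W_mul_transpose_W : D.W * D.Wᵀ = 1 :=
  (Matrix.mem_orthogonalGroup_iff (Fin s) ℝ).1 D.W_orthogonal

theorem gram_eq : Cᵀ * C = D.W * Matrix.diagonal (fun i => D.σ i ^ 2) * D.Wᵀ := by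
  have hU : D.Uᵀ * D.U = 1 := (Matrix.mem_orthogonalGroup_iff' (Fin s) ℝ).1 D.U_orthogonal
  conv_lhs => rw [D.eq_mul]
  simp only [Matrix.transpose_mul, Matrix.transpose_transpose, Matrix.diagonal_transpose]
  calc _ = D.W * Matrix.diagonal D.σ * (D.Uᵀ * D.U) * Matrix.diagonal D.σ * D.Wᵀ := by
        simp only [Matrix.mul_assoc]
    _ = _ := by
        rw [hU, Matrix.mul_one, Matrix.mul_assoc D.W, Matrix.diagonal_mul_diagonal]
        simp only [sq]

theorem vecNorm_transpose_W_mulVec (x : Fin s → ℝ) : vecNorm (D.Wᵀ *ᵥ x) ^ 2 = vecNorm x ^ 2 := by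
  rw [vecNorm_sq_eq_dotProduct, mulVec_dotProduct_mulVec, Matrix.transpose_transpose,
    D.W_mul_transpose_W, Matrix.one_mulVec, vecNorm_sq_eq_dotProduct]

theorem vecNorm_mulVec_sq (x : Fin s → ℝ) :
    vecNorm (C *ᵥ x) ^ 2 = ∑ i, D.σ i ^ 2 * (D.Wᵀ *ᵥ x) i ^ 2 := by
  rw [vecNorm_sq_eq_dotProduct, mulVec_dotProduct_mulVec, D.gram_eq, Matrix.mul_assoc,
    ← Matrix.mulVec_mulVec, Matrix.dotProduct_mulVec, ← Matrix.mulVec_transpose,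
    ← Matrix.mulVec_mulVec, dotProduct]
  exact Finset.sum_congr rfl fun i _ => by rw [Matrix.mulVec_diagonal]; ring

/-- One half of the Courant–Fischer principle: if `‖C x‖² ≥ μ ‖x‖²` on a subspace of dimension
greater than `l`, then the singular value with index `l` (counted from `0`) is at least `√μ`. -/
theorem le_sigma_sq (S : Submodule ℝ (Fin s → ℝ)) {μ : ℝ}
    (hS : ∀ x ∈ S, μ * vecNorm x ^ 2 ≤ vecNorm (C *ᵥ x) ^ 2) {l : Fin s}
    (hl : (l : ℕ) < Module.finrank ℝ S) : μ ≤ D.σ l ^ 2 := by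
  -- The subspace meets the orthogonal complement of the first `l` right singular vectors.
  let f : S →ₗ[ℝ] (Fin l → ℝ) :=
    (LinearMap.funLeft ℝ ℝ (Fin.castLE l.2.le)) ∘ₗ D.Wᵀ.mulVecLin ∘ₗ S.subtype
  have hker : LinearMap.ker f ≠ ⊥ := LinearMap.ker_ne_bot_of_finrank_lt (by simpa using hl)
  obtain ⟨x, hx, hx0⟩ := Submodule.exists_mem_ne_zero_of_ne_bot hker
  have hcoef : ∀ i : Fin s, i < l → (D.Wᵀ *ᵥ x.1) i = 0 := fun i hi =>
    congrFun (LinearMap.mem_ker.1 hx) ⟨i, hi⟩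
  have hpos : 0 < vecNorm x.1 := vecNorm_pos fun h => hx0 (Subtype.ext h)
  have hle : vecNorm (C *ᵥ x.1) ^ 2 ≤ D.σ l ^ 2 * vecNorm x.1 ^ 2 := by
    rw [D.vecNorm_mulVec_sq, ← D.vecNorm_transpose_W_mulVec, vecNorm_sq, Finset.mul_sum]
    refine Finset.sum_le_sum fun i _ => ?_
    rcases lt_or_ge i l with hi | hi
    · simp [hcoef i hi]
    · gcongr
      · exact D.σ_nonneg i
      · exact D.σ_antitone hi
  exact le_of_mul_le_mul_right ((hS x.1 x.2).trans hle) (by positivity)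

/-- The matrix whose `l`-th column is `ω⁽ˡ⁾ / σ⁽ˡ⁾`, a scaled right singular vector, for the first
`k` indices `l`. It turns `R` into the approximate left singular matrix. -/
def scaledRight {k : ℕ} (hk : k ≤ s) : Matrix (Fin s) (Fin k) ℝ :=
  Matrix.of fun b l => D.W b (Fin.castLE hk l) / D.σ (Fin.castLE hk l)

theorem approxV_eq {n k : ℕ} (hk : k ≤ s) (R : Matrix (Fin n) (Fin s) ℝ) :
    approxV k R D = R * D.scaledRight hk := by
  ext a l
  have hl : l.1 < s := l.2.trans_le hk
  simp only [approxV, Matrix.of_apply, dif_pos hl, Matrix.mulVec, dotProduct, Matrix.mul_apply,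
    scaledRight, Finset.sum_div, mul_div_assoc]
  rfl

theorem scaledRight_eq {k : ℕ} (hk : k ≤ s) : D.scaledRight hk =
    D.W.submatrix id (Fin.castLE hk) * Matrix.diagonal fun l => (D.σ (Fin.castLE hk l))⁻¹ := by
  ext b l
  rw [Matrix.mul_diagonal]
  simp [scaledRight, div_eq_mul_inv]

theorem scaledRight_gram {k : ℕ} (hk : k ≤ s) : (D.scaledRight hk)ᵀ * D.scaledRight hk =
    Matrix.diagonal fun l => ((D.σ (Fin.castLE hk l)) ^ 2)⁻¹ := by
  ext l l'
  have h := congrFun (congrFun D.transpose_W_mul_W (Fin.castLE hk l)) (Fin.castLE hk l')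
  rw [Matrix.mul_apply] at h
  simp only [Matrix.mul_apply, Matrix.transpose_apply, scaledRight, Matrix.of_apply] at h ⊢
  calc _ = (∑ b, D.W b (Fin.castLE hk l) * D.W b (Fin.castLE hk l')) *
        ((D.σ (Fin.castLE hk l))⁻¹ * (D.σ (Fin.castLE hk l'))⁻¹) := by
        rw [Finset.sum_mul]
        exact Finset.sum_congr rfl fun b _ => by ring
    _ = _ := by
        rw [h]
        by_cases hll : l = l'
        · subst hll
          simp [sq]
        · simp [hll]

theorem scaledRight_gram_image {k : ℕ} (hk : k ≤ s) (hσ : ∀ l, D.σ (Fin.castLE hk l) ≠ 0) :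
    (D.scaledRight hk)ᵀ * (Cᵀ * C) * D.scaledRight hk = 1 := by
  have h : D.Wᵀ * D.scaledRight hk =
      Matrix.of fun i l => if i = Fin.castLE hk l then (D.σ (Fin.castLE hk l))⁻¹ else 0 := by
    ext i l
    rw [D.scaledRight_eq, ← Matrix.mul_assoc, Matrix.mul_diagonal]
    have := congrFun (congrFun D.transpose_W_mul_W i) (Fin.castLE hk l)
    rw [Matrix.mul_apply] at this ⊢
    simp only [Matrix.submatrix_apply, id, this, Matrix.one_apply, Matrix.of_apply]
    split_ifs <;> simp
  have h' : (D.scaledRight hk)ᵀ * D.W = (D.Wᵀ * D.scaledRight hk)ᵀ := by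
    rw [Matrix.transpose_mul, Matrix.transpose_transpose]
  rw [D.gram_eq]
  calc _ = (D.scaledRight hk)ᵀ * D.W * Matrix.diagonal (fun i => D.σ i ^ 2) *
        (D.Wᵀ * D.scaledRight hk) := by simp only [Matrix.mul_assoc]
    _ = 1 := by
      rw [h', h]
      ext l l'
      have := hσ l
      rw [Matrix.mul_apply]
      simp only [Matrix.mul_diagonal, Matrix.transpose_apply, Matrix.of_apply, ite_mul, zero_mul,
        mul_ite, mul_zero, Finset.sum_ite_eq', Finset.mem_univ, if_true,
        Matrix.one_apply]
      by_cases hll : l = l'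
      · subst hll
        simp
        field_simp
      · have : l' ≠ l := Ne.symm hll
        simp [hll, this]

end SVD

theorem abs_dotProduct_mulVec_le {n : ℕ} (A : Matrix (Fin n) (Fin n) ℝ) {θ : ℝ}
    (hA : frobNorm A ≤ θ) (x y : Fin n → ℝ) :
    |x ⬝ᵥ (A *ᵥ y)| ≤ θ * (vecNorm x * vecNorm y) := by
  calc _ ≤ vecNorm x * vecNorm (A *ᵥ y) := abs_dotProduct_le _ _
    _ ≤ vecNorm x * (θ * vecNorm y) := by
        refine mul_le_mul_of_nonneg_left ?_ (vecNorm_nonneg x)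
        exact (vecNorm_mulVec_le_frobNorm A y).trans
          (mul_le_mul_of_nonneg_right hA (vecNorm_nonneg y))
    _ = _ := by ring

theorem vecNorm_mulVec_sq_sub_le {n a b : ℕ} (A : Matrix (Fin a) (Fin n) ℝ)
    (B : Matrix (Fin b) (Fin n) ℝ) {θ : ℝ} (h : frobNorm (Aᵀ * A - Bᵀ * B) ≤ θ) (x : Fin n → ℝ) :
    vecNorm (B *ᵥ x) ^ 2 - θ * vecNorm x ^ 2 ≤ vecNorm (A *ᵥ x) ^ 2 := by
  have h1 := abs_dotProduct_mulVec_le _ h x x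
  rw [Matrix.sub_mulVec, dotProduct_sub, ← mulVec_dotProduct_mulVec, ← mulVec_dotProduct_mulVec,
    ← vecNorm_sq_eq_dotProduct, ← vecNorm_sq_eq_dotProduct, ← sq] at h1
  linarith [(abs_le.1 h1).1]

/-- If `R Rᵀ` is close to `H Hᵀ` and `Cᵀ C` is close to `Rᵀ R`, then the `rank H` leading singular
values of `C` are bounded below. The subspace for the Courant–Fischer principle is the image under
`Rᵀ` of the column space of `H`. -/
theorem sigma_sq_lower_bound {n m s : ℕ} (H : Matrix (Fin n) (Fin m) ℝ)
    (R : Matrix (Fin n) (Fin s) ℝ) {C : Matrix (Fin s) (Fin s) ℝ} (D : SVD C) {θ : ℝ}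
    (hR : frobNorm (R * Rᵀ - H * Hᵀ) ≤ θ) (hC : frobNorm (Cᵀ * C - Rᵀ * R) ≤ θ)
    (hθ : θ < sigmaMin H ^ 2) {l : Fin s} (hl : (l : ℕ) < H.rank) :
    sigmaMin H ^ 2 - 2 * θ ≤ D.σ l ^ 2 := by
  set μ := sigmaMin H ^ 2 - θ
  have hμ : 0 < μ := sub_pos.2 hθ
  have hlow : ∀ y ∈ LinearMap.range H.mulVecLin, μ * vecNorm y ^ 2 ≤ vecNorm (Rᵀ *ᵥ y) ^ 2 := by
    rintro _ ⟨x, rfl⟩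
    have h1 := sigmaMin_sq_mul_le H x
    have h2 := vecNorm_mulVec_sq_sub_le Rᵀ Hᵀ (θ := θ)
      (by simpa only [Matrix.transpose_transpose] using hR) (H *ᵥ x)
    simp only [Matrix.mulVecLin_apply, μ]
    linarith
  let f : LinearMap.range H.mulVecLin →ₗ[ℝ] (Fin s → ℝ) :=
    Rᵀ.mulVecLin ∘ₗ (LinearMap.range H.mulVecLin).subtype
  have hinj : Function.Injective f := by
    rw [← LinearMap.ker_eq_bot, LinearMap.ker_eq_bot']
    intro y hy
    have h1 := hlow y.1 y.2
    rw [show Rᵀ *ᵥ y.1 = 0 from hy, vecNorm_eq_zero.2 rfl] at h1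
    have h2 : vecNorm y.1 = 0 := by
      by_contra hne
      have : 0 < μ * vecNorm y.1 ^ 2 := by positivity
      linarith
    exact Subtype.ext (vecNorm_eq_zero.1 h2)
  refine D.le_sigma_sq (LinearMap.range f) (fun x hx => ?_)
    (by rwa [LinearMap.finrank_range_of_inj hinj])
  obtain ⟨y, rfl⟩ := hx
  set z := f y with hz
  have hz' : z = Rᵀ *ᵥ y.1 := rfl
  have hy := hlow y.1 y.2
  rw [← hz'] at hy
  -- `‖z‖² = ⟨y, R z⟩ ≤ ‖y‖ ‖R z‖`, and `‖y‖ ≤ ‖z‖ / √μ`.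
  have h1 : vecNorm z ^ 2 ≤ vecNorm y.1 * vecNorm (R *ᵥ z) := by
    calc vecNorm z ^ 2 = y.1 ⬝ᵥ (R *ᵥ z) := by
          rw [vecNorm_sq_eq_dotProduct]
          nth_rewrite 1 [hz']
          rw [Matrix.mulVec_transpose, ← Matrix.dotProduct_mulVec]
      _ ≤ _ := (le_abs_self _).trans (abs_dotProduct_le _ _)
  have h2 : μ * vecNorm z ^ 2 ≤ vecNorm (R *ᵥ z) ^ 2 := by
    rcases (vecNorm_nonneg z).eq_or_lt with h | h
    · rw [← h]; simp only [ne_eq, OfNat.ofNat_ne_zero, not_false_eq_true, zero_pow, mul_zero]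
      positivity
    · have h3 : (vecNorm z ^ 2) ^ 2 ≤ vecNorm y.1 ^ 2 * vecNorm (R *ᵥ z) ^ 2 := by
        rw [← mul_pow]; exact pow_le_pow_left₀ (sq_nonneg _) h1 2
      have h4 := mul_le_mul_of_nonneg_right hy (sq_nonneg (vecNorm (R *ᵥ z)))
      refine le_of_mul_le_mul_right (a := vecNorm z ^ 2) ?_ (by positivity)
      nlinarith
  have h5 := vecNorm_mulVec_sq_sub_le C R hC z
  simp only [μ] at h2
  linarith

/-- The approximate left singular matrix has nearly orthonormal columns:
`Ṽᵀ Ṽ - 1 = Pᵀ (Rᵀ R - Cᵀ C) P` for a matrix `P` of norm at most `1 / σ⁽ᵏ⁾`. -/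
theorem vecNorm_gram_sub_one_le {n s k : ℕ} (hk : k ≤ s) (R : Matrix (Fin n) (Fin s) ℝ)
    {C : Matrix (Fin s) (Fin s) ℝ} (D : SVD C) {θ μ : ℝ} (hC : frobNorm (Cᵀ * C - Rᵀ * R) ≤ θ)
    (hμ : 0 < μ) (hσ : ∀ l : Fin k, μ ≤ D.σ (Fin.castLE hk l) ^ 2) (x : Fin k → ℝ) :
    vecNorm (((approxV k R D)ᵀ * approxV k R D - 1) *ᵥ x) ≤ θ / μ * vecNorm x := by
  set P := D.scaledRight hk
  have hθ : 0 ≤ θ := (frobNorm_nonneg _).trans hC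
  have hne : ∀ l : Fin k, D.σ (Fin.castLE hk l) ≠ 0 := fun l h => by
    have := hσ l
    rw [h] at this
    norm_num at this
    linarith
  have hP : ∀ x : Fin k → ℝ, vecNorm (P *ᵥ x) ^ 2 ≤ vecNorm x ^ 2 / μ := by
    intro x
    rw [vecNorm_sq_eq_dotProduct, mulVec_dotProduct_mulVec, D.scaledRight_gram, vecNorm_sq,
      Finset.sum_div, dotProduct]
    refine Finset.sum_le_sum fun l _ => ?_
    rw [Matrix.mulVec_diagonal]
    calc _ = x l ^ 2 / D.σ (Fin.castLE hk l) ^ 2 := by ring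
      _ ≤ _ := by gcongr; exact hσ l
  have hPP : ∀ x y : Fin k → ℝ,
      vecNorm (P *ᵥ x) * vecNorm (P *ᵥ y) ≤ vecNorm x * vecNorm y / μ := by
    intro x y
    refine le_of_sq_le_sq ?_ (div_nonneg (mul_nonneg (vecNorm_nonneg x) (vecNorm_nonneg y)) hμ.le)
    calc _ = vecNorm (P *ᵥ x) ^ 2 * vecNorm (P *ᵥ y) ^ 2 := by ring
      _ ≤ vecNorm x ^ 2 / μ * (vecNorm y ^ 2 / μ) := by
          gcongr
          · exact hP x
          · exact hP y
      _ = _ := by ring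
  have hG : (approxV k R D)ᵀ * approxV k R D - 1 = -(Pᵀ * ((Cᵀ * C - Rᵀ * R) * P)) := by
    rw [D.approxV_eq hk, ← D.scaledRight_gram_image hk hne, Matrix.transpose_mul, Matrix.sub_mul,
      Matrix.mul_sub, neg_sub]
    simp only [Matrix.mul_assoc, P]
  set y := ((approxV k R D)ᵀ * approxV k R D - 1) *ᵥ x with hy
  have h1 : vecNorm y ^ 2 ≤ θ / μ * vecNorm x * vecNorm y := by
    calc vecNorm y ^ 2 = y ⬝ᵥ y := vecNorm_sq_eq_dotProduct y
      _ = -((P *ᵥ y) ⬝ᵥ ((Cᵀ * C - Rᵀ * R) *ᵥ (P *ᵥ x))) := by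
          nth_rewrite 2 [hy]
          rw [hG, Matrix.neg_mulVec, dotProduct_neg, ← Matrix.mulVec_mulVec,
            Matrix.dotProduct_mulVec, ← Matrix.mulVec_transpose, Matrix.transpose_transpose,
            ← Matrix.mulVec_mulVec]
      _ ≤ θ * (vecNorm (P *ᵥ y) * vecNorm (P *ᵥ x)) :=
          (neg_le_abs _).trans (abs_dotProduct_mulVec_le _ hC _ _)
      _ ≤ θ * (vecNorm y * vecNorm x / μ) := mul_le_mul_of_nonneg_left (hPP y x) hθ
      _ = _ := by ring
  rcases (vecNorm_nonneg y).eq_or_lt with h | h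
  · rw [← h]
    exact mul_nonneg (by positivity) (vecNorm_nonneg x)
  · refine le_of_mul_le_mul_right ?_ h
    linarith

section NearIsometry

variable {n k : ℕ} {V : Matrix (Fin n) (Fin k) ℝ} {δ : ℝ}

theorem abs_vecNorm_mulVec_sq_sub_le
    (hV : ∀ x, vecNorm ((Vᵀ * V - 1) *ᵥ x) ≤ δ * vecNorm x) (x : Fin k → ℝ) :
    |vecNorm (V *ᵥ x) ^ 2 - vecNorm x ^ 2| ≤ δ * vecNorm x ^ 2 := by
  have h : vecNorm (V *ᵥ x) ^ 2 - vecNorm x ^ 2 = x ⬝ᵥ ((Vᵀ * V - 1) *ᵥ x) := by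
    rw [Matrix.sub_mulVec, dotProduct_sub, ← mulVec_dotProduct_mulVec, Matrix.one_mulVec,
      vecNorm_sq_eq_dotProduct, vecNorm_sq_eq_dotProduct]
  rw [h]
  calc _ ≤ vecNorm x * (δ * vecNorm x) := (abs_dotProduct_le _ _).trans
        (mul_le_mul_of_nonneg_left (hV x) (vecNorm_nonneg x))
    _ = _ := by ring

/-- If `V` has nearly orthonormal columns in the column space of `H`, as many as the rank of `H`,
then they span it. -/
theorem exists_mulVec_eq {m : ℕ} {H : Matrix (Fin n) (Fin m) ℝ}
    {V : Matrix (Fin n) (Fin H.rank) ℝ} {M : Matrix (Fin m) (Fin H.rank) ℝ} (hM : V = H * M)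
    (hδ : δ < 1) (hV : ∀ x, vecNorm ((Vᵀ * V - 1) *ᵥ x) ≤ δ * vecNorm x) (B : Fin m → ℝ) :
    ∃ x, V *ᵥ x = H *ᵥ B := by
  have hinj : Function.Injective V.mulVecLin := by
    rw [← LinearMap.ker_eq_bot, LinearMap.ker_eq_bot']
    intro x hx
    have h1 := abs_vecNorm_mulVec_sq_sub_le hV x
    rw [show V *ᵥ x = 0 from hx, vecNorm_eq_zero.2 rfl] at h1
    have h2 := (abs_le.1 h1).1
    by_contra hne
    have := vecNorm_pos hne
    nlinarith [sq_pos_of_pos this]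
  have hle : LinearMap.range V.mulVecLin ≤ LinearMap.range H.mulVecLin := by
    rw [hM, Matrix.mulVecLin_mul]
    exact LinearMap.range_comp_le_range _ _
  have heq := Submodule.eq_of_le_of_finrank_eq hle (by
    rw [LinearMap.finrank_range_of_inj hinj, Module.finrank_fin_fun]; rfl)
  have : H *ᵥ B ∈ LinearMap.range V.mulVecLin := heq ▸ LinearMap.mem_range_self H.mulVecLin B
  exact this

/-- If the columns of `V` are nearly orthonormal, then `V q` is close to a vector `y` of their span
as soon as `q` is close to `Vᵀ y`. With `y = V x`, the error is
`V (q - Vᵀ y) + V (Vᵀ V - 1) x`. -/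
theorem vecNorm_mulVec_sub_le {ε : ℝ} (hε0 : 0 < ε) (hε1 : ε ≤ 1)
    (hV : ∀ x, vecNorm ((Vᵀ * V - 1) *ᵥ x) ≤ ε / 8 * vecNorm x) {x : Fin k → ℝ} {q : Fin k → ℝ}
    (hq : vecNorm (q - Vᵀ *ᵥ (V *ᵥ x)) ≤ ε / 4 * vecNorm (V *ᵥ x)) :
    vecNorm (V *ᵥ q - V *ᵥ x) ≤ ε / 2 * vecNorm (V *ᵥ x) := by
  have hup : ∀ z : Fin k → ℝ, vecNorm (V *ᵥ z) ≤ 17 / 16 * vecNorm z := by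
    intro z
    have h1 := (abs_le.1 (abs_vecNorm_mulVec_sq_sub_le hV z)).2
    refine le_of_sq_le_sq ?_ (mul_nonneg (by norm_num) (vecNorm_nonneg z))
    nlinarith [sq_nonneg (vecNorm z)]
  have hlow : vecNorm x ≤ 17 / 15 * vecNorm (V *ᵥ x) := by
    have h1 := (abs_le.1 (abs_vecNorm_mulVec_sq_sub_le hV x)).1
    refine le_of_sq_le_sq ?_ (mul_nonneg (by norm_num) (vecNorm_nonneg _))
    nlinarith [sq_nonneg (vecNorm x)]
  have hdec : V *ᵥ q - V *ᵥ x = V *ᵥ (q - Vᵀ *ᵥ (V *ᵥ x)) + V *ᵥ ((Vᵀ * V - 1) *ᵥ x) := by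
    rw [← Matrix.mulVec_add, Matrix.sub_mulVec, Matrix.mulVec_mulVec, Matrix.one_mulVec,
      sub_add_sub_cancel, Matrix.mulVec_sub]
  rw [hdec]
  refine (vecNorm_add_le _ _).trans ?_
  have h1 := hup (q - Vᵀ *ᵥ (V *ᵥ x))
  have h2 := hup ((Vᵀ * V - 1) *ᵥ x)
  have h3 := hV x
  have h4 : ε / 8 * vecNorm x ≤ ε / 8 * (17 / 15 * vecNorm (V *ᵥ x)) := by gcongr
  have h5 : 0 ≤ ε * vecNorm (V *ᵥ x) := mul_nonneg hε0.le (vecNorm_nonneg _)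
  linarith

end NearIsometry

/-! ### From vectors to length-square distributions -/

theorem tvDist_lsDist_le {ι : Type*} [Fintype ι] {v w : ι → ℝ} (hv : v ≠ 0) (hw : w ≠ 0) :
    tvDist (lsDist v) (lsDist w) ≤ 2 * vecNorm (v - w) / vecNorm w := by
  have hv' := vecNorm_pos hv
  have hw' := vecNorm_pos hw
  set a : ι → ℝ := (vecNorm v)⁻¹ • v with ha
  set b : ι → ℝ := (vecNorm w)⁻¹ • w with hb
  have hna : vecNorm a = 1 := by rw [ha, vecNorm_smul, abs_of_pos (by positivity)]; field_simp
  have hnb : vecNorm b = 1 := by rw [hb, vecNorm_smul, abs_of_pos (by positivity)]; field_simp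
  -- `∑ |aᵢ² - bᵢ²| = ⟨|a - b|, |a + b|⟩ ≤ ‖a - b‖ ‖a + b‖` for the normalized vectors.
  have h1 : ∑ i, |lsDist v i - lsDist w i| ≤ vecNorm (a - b) * vecNorm (a + b) := by
    have e : ∑ i, |lsDist v i - lsDist w i| = (fun i => |(a - b) i|) ⬝ᵥ fun i => |(a + b) i| := by
      refine Finset.sum_congr rfl fun i _ => ?_
      rw [← abs_mul]
      congr 1
      simp only [lsDist, ha, hb, Pi.sub_apply, Pi.add_apply, Pi.smul_apply, smul_eq_mul, div_pow,
        sq_abs]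
      ring
    have habs : ∀ u : ι → ℝ, vecNorm (fun i => |u i|) = vecNorm u := fun u => by
      refine (pow_left_inj₀ (vecNorm_nonneg _) (vecNorm_nonneg _) two_ne_zero).1 ?_
      simp only [vecNorm_sq, sq_abs]
    rw [e]
    refine (le_abs_self _).trans ((abs_dotProduct_le _ _).trans ?_)
    rw [habs, habs]
  have h2 : vecNorm (a + b) ≤ 2 := (vecNorm_add_le a b).trans (by rw [hna, hnb]; norm_num)
  have h3 : vecNorm (a - b) ≤ 2 * vecNorm (v - w) / vecNorm w := by
    have e : a - b = (vecNorm w)⁻¹ • (v - w) + (vecNorm w)⁻¹ • ((vecNorm w - vecNorm v) • a) := by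
      simp only [ha, hb, smul_smul]
      ext i
      simp only [Pi.sub_apply, Pi.add_apply, Pi.smul_apply, smul_eq_mul]
      field_simp
      ring
    rw [e]
    refine (vecNorm_add_le _ _).trans ?_
    rw [vecNorm_smul, vecNorm_smul, vecNorm_smul, hna, abs_of_pos (inv_pos.2 hw'), abs_sub_comm]
    have := abs_vecNorm_sub_vecNorm_le v w
    rw [mul_one, ← mul_add, div_eq_inv_mul]
    gcongr
    linarith
  rw [tvDist]
  have h4 := mul_le_mul_of_nonneg_left h2 (vecNorm_nonneg (a - b))
  linarith

/-! ### Length-square sampling of columns and rows -/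

theorem lsDist_nonneg {ι : Type*} [Fintype ι] (v : ι → ℝ) (i : ι) : 0 ≤ lsDist v i := sq_nonneg _

theorem lsDist_eq {ι : Type*} [Fintype ι] (v : ι → ℝ) (i : ι) :
    lsDist v i = v i ^ 2 / vecNorm v ^ 2 := by
  rw [lsDist, div_pow, sq_abs]

theorem sum_lsDist {ι : Type*} [Fintype ι] {v : ι → ℝ} (hv : v ≠ 0) : ∑ i, lsDist v i = 1 := by
  have := vecNorm_pos hv
  simp_rw [lsDist_eq]
  rw [← Finset.sum_div, ← vecNorm_sq]
  field_simp

section Sampling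

variable {n m : ℕ} (A : Matrix (Fin n) (Fin m) ℝ)

theorem colProb_nonneg (j : Fin m) : 0 ≤ colProb A j := sq_nonneg _

theorem frobNorm_sq_eq_sum_col : frobNorm A ^ 2 = ∑ j, vecNorm (fun a => A a j) ^ 2 := by
  rw [frobNorm_sq, Finset.sum_comm]
  simp_rw [vecNorm_sq]

variable {A}

theorem sum_colProb (hA : frobNorm A ≠ 0) : ∑ j, colProb A j = 1 := by
  simp_rw [colProb, div_pow]
  rw [← Finset.sum_div, ← frobNorm_sq_eq_sum_col]
  field_simp

theorem vecNorm_col_sq (hA : frobNorm A ≠ 0) (j : Fin m) :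
    vecNorm (fun a => A a j) ^ 2 = colProb A j * frobNorm A ^ 2 := by
  rw [colProb, div_pow]
  field_simp

theorem col_eq_zero (hA : frobNorm A ≠ 0) {j : Fin m} (hj : colProb A j = 0) (a : Fin n) :
    A a j = 0 := by
  have h := vecNorm_col_sq hA j
  rw [hj, zero_mul, sq_eq_zero_iff, vecNorm_eq_zero] at h
  exact congrFun h a

theorem norm_toLp_eq_frobNorm (M : Matrix (Fin n) (Fin m) ℝ) :
    ‖(WithLp.toLp 2 fun q : Fin n × Fin m => M q.1 q.2 :
      EuclideanSpace ℝ (Fin n × Fin m))‖ = frobNorm M := by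
  refine (pow_left_inj₀ (norm_nonneg _) (frobNorm_nonneg _) two_ne_zero).1 ?_
  rw [EuclideanSpace.real_norm_sq_eq, frobNorm_sq, Fintype.sum_prod_type]

theorem frobNorm_vecMulVec (v : Fin n → ℝ) (w : Fin m → ℝ) :
    frobNorm (Matrix.vecMulVec v w) = vecNorm v * vecNorm w := by
  refine (pow_left_inj₀ (frobNorm_nonneg _) (mul_nonneg (vecNorm_nonneg _) (vecNorm_nonneg _))
    two_ne_zero).1 ?_
  rw [frobNorm_sq, mul_pow, vecNorm_sq, vecNorm_sq, Finset.sum_mul_sum]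
  simp only [Matrix.vecMulVec_apply, mul_pow]

theorem frobNorm_mul_transpose_le (A : Matrix (Fin n) (Fin m) ℝ) :
    frobNorm (A * Aᵀ) ≤ frobNorm A ^ 2 := by
  have h := Matrix.frobenius_norm_mul A Aᵀ
  rw [Matrix.frobenius_norm_transpose] at h
  rw [sq]
  exact h

theorem frobNorm_smul (a : ℝ) (M : Matrix (Fin n) (Fin m) ℝ) :
    frobNorm (a • M) = |a| * frobNorm M := by
  rw [← norm_toLp_eq_frobNorm, ← norm_toLp_eq_frobNorm, ← Real.norm_eq_abs, ← norm_smul]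
  rfl

theorem frobNorm_sub_le (M N : Matrix (Fin n) (Fin m) ℝ) :
    frobNorm (M - N) ≤ frobNorm M + frobNorm N := by
  rw [← norm_toLp_eq_frobNorm, ← norm_toLp_eq_frobNorm, ← norm_toLp_eq_frobNorm]
  exact norm_sub_le (WithLp.toLp 2 fun q : Fin n × Fin m => M q.1 q.2)
    (WithLp.toLp 2 fun q : Fin n × Fin m => N q.1 q.2)

open Classical in
/-- Length-square column sampling approximates `A Aᵀ` in Frobenius norm. The column indices are
`g i` for independent random `i` with weights `p`, so that the lemma also covers indices that are
components of larger samples; only the distribution of `g i` matters. -/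
theorem sampledR_concentration (hA : frobNorm A ≠ 0) {ι : Type*} [Fintype ι] (p : ι → ℝ)
    (hp : ∀ i, 0 ≤ p i) (g : ι → Fin m)
    (hg : ∀ f : Fin m → ℝ, ∑ i, p i * f (g i) = ∑ j, colProb A j * f j) {s : ℕ} (hs : 0 < s)
    {r : ℝ} (hr : 0 ≤ r) :
    1 - 2 * Real.exp (-(r ^ 2 * s / (8 * frobNorm A ^ 4))) ≤
      ∑ c : Fin s → ι, if frobNorm (sampledR A (fun t => g (c t)) *
        (sampledR A fun t => g (c t))ᵀ - A * Aᵀ) ≤ r then ∏ t, p (c t) else 0 := by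
  have hs' : (0 : ℝ) < s := by exact_mod_cast hs
  have hF : 0 < frobNorm A := lt_of_le_of_ne (frobNorm_nonneg A) (Ne.symm hA)
  have hp1 : ∑ i, p i = 1 := by
    have := hg fun _ => 1
    simpa [sum_colProb hA] using this
  let col : Fin m → Fin n → ℝ := fun j a => A a j
  let Y : Fin m → Matrix (Fin n) (Fin n) ℝ := fun j =>
    (s : ℝ)⁻¹ • ((colProb A j)⁻¹ • Matrix.vecMulVec (col j) (col j) - A * Aᵀ)
  let X : ι → EuclideanSpace ℝ (Fin n × Fin n) := fun i =>
    WithLp.toLp 2 fun q => Y (g i) q.1 q.2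
  have hX0 : ∑ i, p i • X i = 0 := by
    ext q
    have h1 := hg fun j => Y j q.1 q.2
    have h2 : ∑ j, colProb A j * Y j q.1 q.2 = 0 := by
      have h3 : ∀ j, colProb A j * Y j q.1 q.2 =
          (s : ℝ)⁻¹ * (A q.1 j * A q.2 j) - (s : ℝ)⁻¹ * (A * Aᵀ) q.1 q.2 * colProb A j := by
        intro j
        simp only [Y, Matrix.smul_apply, Matrix.sub_apply, Matrix.vecMulVec_apply, smul_eq_mul, col]
        rcases eq_or_ne (colProb A j) 0 with h | h
        · rw [h, col_eq_zero hA h]; ring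
        · field_simp
      simp_rw [h3]
      rw [Finset.sum_sub_distrib, ← Finset.mul_sum, ← Finset.mul_sum, sum_colProb hA,
        Matrix.mul_apply]
      simp
    simpa [X] using h1.trans h2
  have hXb : ∀ i, p i ≠ 0 → ‖X i‖ ≤ 2 * frobNorm A ^ 2 / s := by
    intro i _
    have h1 : frobNorm ((colProb A (g i))⁻¹ • Matrix.vecMulVec (col (g i)) (col (g i))) ≤
        frobNorm A ^ 2 := by
      rw [frobNorm_smul, frobNorm_vecMulVec, ← sq, vecNorm_col_sq hA,
        abs_of_nonneg (inv_nonneg.2 (colProb_nonneg A _))]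
      rcases eq_or_ne (colProb A (g i)) 0 with h | h
      · rw [h]; simp; positivity
      · rw [inv_mul_cancel_left₀ h]
    have h2 := frobNorm_mul_transpose_le A
    have h3 := frobNorm_sub_le
      ((colProb A (g i))⁻¹ • Matrix.vecMulVec (col (g i)) (col (g i))) (A * Aᵀ)
    simp only [X]
    rw [norm_toLp_eq_frobNorm, frobNorm_smul, abs_of_pos (inv_pos.2 hs'), div_eq_inv_mul]
    gcongr
    linarith
  have hsum : ∀ c : Fin s → ι, ‖∑ t, X (c t)‖ = frobNorm (sampledR A (fun t => g (c t)) *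
      (sampledR A fun t => g (c t))ᵀ - A * Aᵀ) := by
    intro c
    rw [← norm_toLp_eq_frobNorm]
    congr 1
    ext q
    simp only [X, Y, WithLp.ofLp_sum, Finset.sum_apply, Matrix.smul_apply, Matrix.sub_apply,
      smul_eq_mul, Matrix.vecMulVec_apply, col, mul_sub, Finset.sum_sub_distrib, Finset.sum_const,
      Finset.card_univ, Fintype.card_fin, nsmul_eq_mul]
    rw [mul_inv_cancel_left₀ hs'.ne', Matrix.mul_apply]
    congr 1
    refine Finset.sum_congr rfl fun t _ => ?_
    have h0 : 0 ≤ s * colProb A (g (c t)) := mul_nonneg hs'.le (colProb_nonneg A _)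
    simp only [sampledR, Matrix.transpose_apply, Matrix.of_apply]
    rw [div_mul_div_comm, Real.mul_self_sqrt h0, div_eq_mul_inv, mul_inv]
    ring
  have h := norm_sum_concentration p hp hp1 X hX0 (b := 2 * frobNorm A ^ 2 / s) (by positivity)
    hXb hs hr
  simp_rw [hsum] at h
  convert h using 4
  field_simp
  norm_num

variable {s : ℕ} {c : Fin s → Fin m}

theorem vecNorm_sampledR_col_sq (hA : frobNorm A ≠ 0) (t : Fin s)
    (hc : colProb A (c t) ≠ 0) :
    vecNorm (fun a => sampledR A c a t) ^ 2 = frobNorm A ^ 2 / s := by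
  have h0 : 0 ≤ s * colProb A (c t) := mul_nonneg (Nat.cast_nonneg s) (colProb_nonneg A _)
  have hs : (s : ℝ) ≠ 0 := by
    have := t.pos
    positivity
  have h := vecNorm_col_sq hA (c t)
  rw [vecNorm_sq] at h ⊢
  simp only [sampledR, Matrix.of_apply, div_pow, Real.sq_sqrt h0]
  rw [← Finset.sum_div, h]
  field_simp

theorem frobNorm_sampledR (hA : frobNorm A ≠ 0) (hs : 0 < s) (hc : ∀ t, colProb A (c t) ≠ 0) :
    frobNorm (sampledR A c) = frobNorm A := by
  refine (pow_left_inj₀ (frobNorm_nonneg _) (frobNorm_nonneg _) two_ne_zero).1 ?_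
  rw [frobNorm_sq_eq_sum_col, Finset.sum_congr rfl fun t _ => vecNorm_sampledR_col_sq hA t (hc t)]
  have hs' : (0 : ℝ) < s := by exact_mod_cast hs
  simp only [Finset.sum_const, Finset.card_univ, Fintype.card_fin, nsmul_eq_mul]
  field_simp

theorem exists_sampledR_eq_mul (A : Matrix (Fin n) (Fin m) ℝ) (c : Fin s → Fin m) :
    ∃ M : Matrix (Fin m) (Fin s) ℝ, sampledR A c = A * M := by
  refine ⟨Matrix.of fun j t => if j = c t then (√(s * colProb A (c t)))⁻¹ else 0, ?_⟩
  ext a t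
  simp [sampledR, Matrix.mul_apply, div_eq_mul_inv]

theorem sampledC_eq_transpose {n s : ℕ} (R : Matrix (Fin n) (Fin s) ℝ) (j : Fin s → Fin n) :
    sampledC R j = (sampledR Rᵀ j)ᵀ := by
  ext r t
  simp only [sampledC, sampledR, rowProb, colProb, Matrix.of_apply, Matrix.transpose_apply,
    frobNorm_transpose]

/-- A uniform column index `t` and then a row index drawn from `P_{R(:, t)}` give the
length-square distribution on rows, because all columns of `R` have the same norm. -/
theorem sum_row_marginal (hA : frobNorm A ≠ 0) (hs : 0 < s) (hc : ∀ t, colProb A (c t) ≠ 0)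
    (f : Fin n → ℝ) :
    ∑ d : Fin s × Fin n, (1 / (s : ℝ) * lsDist (fun a => sampledR A c a d.1) d.2) * f d.2 =
      ∑ j, colProb (sampledR A c)ᵀ j * f j := by
  have hs' : (0 : ℝ) < s := by exact_mod_cast hs
  rw [Fintype.sum_prod_type, Finset.sum_comm]
  refine Finset.sum_congr rfl fun j _ => ?_
  change ∑ t, 1 / (s : ℝ) * lsDist (fun a => sampledR A c a t) j * f j = _
  rw [← Finset.sum_mul, colProb, frobNorm_transpose, frobNorm_sampledR hA hs hc, div_pow,
    vecNorm_sq, Finset.sum_div]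
  congr 1
  refine Finset.sum_congr rfl fun t _ => ?_
  rw [lsDist_eq, vecNorm_sampledR_col_sq hA t (hc t), Matrix.transpose_apply]
  field_simp

end Sampling

/-! ### Inner product estimation -/

section InnerProduct

variable {n m : ℕ} (H : Matrix (Fin n) (Fin m) ℝ) {B : Fin m → ℝ} {v : Fin n → ℝ}

theorem zProb_nonneg (B : Fin m → ℝ) (v : Fin n → ℝ) (p : Fin n × Fin m) : 0 ≤ zProb B v p :=
  mul_nonneg (lsDist_nonneg _ _) (lsDist_nonneg _ _)

theorem sum_zProb (hB : B ≠ 0) (hv : v ≠ 0) : ∑ p, zProb B v p = 1 := by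
  simp only [zProb]
  rw [Fintype.sum_prod_type, ← Finset.sum_mul_sum, sum_lsDist hB, sum_lsDist hv, one_mul]

theorem sum_zProb_mul_zValue (hB : B ≠ 0) (hv : v ≠ 0) :
    ∑ p, zProb B v p * zValue H B v p = v ⬝ᵥ (H *ᵥ B) := by
  have hB' := vecNorm_pos hB
  have hv' := vecNorm_pos hv
  have h : ∀ p, zProb B v p * zValue H B v p = v p.1 * (H p.1 p.2 * B p.2) := by
    intro p
    rw [zProb, zValue, lsDist_eq, lsDist_eq]
    rcases eq_or_ne (v p.1) 0 with h1 | h1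
    · simp [h1]
    rcases eq_or_ne (B p.2) 0 with h2 | h2
    · simp [h2]
    field_simp
  simp_rw [h, Fintype.sum_prod_type, ← Finset.mul_sum]
  rfl

theorem sum_zProb_mul_zValue_sq_le (hB : B ≠ 0) (hv : v ≠ 0) :
    ∑ p, zProb B v p * zValue H B v p ^ 2 ≤ vecNorm v ^ 2 * vecNorm B ^ 2 * frobNorm H ^ 2 := by
  have hB' := vecNorm_pos hB
  have hv' := vecNorm_pos hv
  rw [frobNorm_sq, ← Fintype.sum_prod_type' (f := fun a b => H a b ^ 2), Finset.mul_sum]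
  refine Finset.sum_le_sum fun p _ => ?_
  rw [zProb, zValue, lsDist_eq, lsDist_eq]
  have h0 : 0 ≤ vecNorm v ^ 2 * vecNorm B ^ 2 * H p.1 p.2 ^ 2 := by positivity
  rcases eq_or_ne (v p.1) 0 with h1 | h1
  · simpa [h1] using h0
  rcases eq_or_ne (B p.2) 0 with h2 | h2
  · simpa [h2] using h0
  refine le_of_eq ?_
  field_simp

open Classical in
theorem medianOfMeans_success {Np Nq : ℕ} (hNp : 0 < Np) (hNq : 0 < Nq) (hB : B ≠ 0) (hv : v ≠ 0)
    {e : ℝ} (he : 0 < e)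
    (h : vecNorm v ^ 2 * vecNorm B ^ 2 * frobNorm H ^ 2 / (Nq * e ^ 2) ≤ 1 / 16) :
    1 - (1 / 2) ^ Np ≤ ∑ z : Fin Np → Fin Nq → Fin n × Fin m,
      if |medianOfMeans H B v z - v ⬝ᵥ (H *ᵥ B)| ≤ e then ∏ a, ∏ b, zProb B v (z a b) else 0 := by
  set w : (Fin Nq → Fin n × Fin m) → ℝ := fun y => ∏ b, zProb B v (y b)
  have hw : ∀ y, 0 ≤ w y := fun y => Finset.prod_nonneg fun _ _ => zProb_nonneg _ _ _
  have hw1 : ∑ y, w y = 1 := by rw [sum_prod_weights, sum_zProb hB hv, one_pow]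
  have hmean := mean_deviation_le (zProb B v) (zProb_nonneg B v) (sum_zProb hB hv)
    (zValue H B v) hNq he
  rw [sum_zProb_mul_zValue H hB hv] at hmean
  have hmed := median_deviation_le w hw hw1 (fun y => (∑ b, zValue H B v (y b)) / (Nq : ℝ))
    (hmean.trans (le_trans (by
      gcongr
      exact sum_zProb_mul_zValue_sq_le H hB hv) h)) hNp
  have htot : ∑ z : Fin Np → Fin Nq → Fin n × Fin m, ∏ a, w (z a) = 1 := by
    rw [sum_prod_weights, hw1, one_pow]
  refine (sub_le_sub_left hmed 1).trans (le_of_eq ?_)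
  rw [← htot, ← Finset.sum_sub_distrib]
  refine Finset.sum_congr rfl fun z _ => ?_
  change ∏ a, w (z a) -
    (if e < |medianOfMeans H B v z - v ⬝ᵥ (H *ᵥ B)| then ∏ a, w (z a) else 0) = _
  by_cases hz : |medianOfMeans H B v z - v ⬝ᵥ (H *ᵥ B)| ≤ e
  · rw [if_pos hz, if_neg (not_lt.2 hz), sub_zero]
  · rw [if_neg hz, if_pos (not_le.1 hz), sub_self]

open Classical in
/-- All `k` estimates are accurate with probability at least `(1 - 2⁻ᴺ)ᵏ` for `N = Np`, as they use
independent samples; Bernoulli's inequality bounds this below by `1 - η / 2`. -/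
theorem qHat_success {k Np Nq : ℕ} (hk : 0 < k) (hNp : 0 < Np) (hNq : 0 < Nq) (hB : B ≠ 0)
    {V : Matrix (Fin n) (Fin k) ℝ} (hV : ∀ l, (fun a => V a l) ≠ 0) {e η : ℝ} (he : 0 < e)
    (hη : (1 / 2 : ℝ) ^ Np ≤ η / (2 * k))
    (h : ∀ l, vecNorm (fun a => V a l) ^ 2 * vecNorm B ^ 2 * frobNorm H ^ 2 / (Nq * e ^ 2) ≤
      1 / 16) :
    1 - η / 2 ≤ ∑ z : Fin k → Fin Np → Fin Nq → Fin n × Fin m,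
      if ∀ l, |qHat H B V z l - (Vᵀ *ᵥ (H *ᵥ B)) l| ≤ e then samplesWeight B V z else 0 := by
  have hk' : (0 : ℝ) < k := by exact_mod_cast hk
  have hle : (1 / 2 : ℝ) ^ Np ≤ 1 := pow_le_one₀ (by norm_num) (by norm_num)
  calc 1 - η / 2 ≤ 1 + k * (-(1 / 2 : ℝ) ^ Np) := by
        have : k * (1 / 2 : ℝ) ^ Np ≤ k * (η / (2 * k)) := by gcongr
        have e1 : k * (η / (2 * k)) = η / 2 := by field_simp
        linarith
    _ ≤ (1 + -(1 / 2 : ℝ) ^ Np) ^ k := one_add_mul_le_pow (by linarith) k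
    _ = ∏ _l : Fin k, (1 - (1 / 2 : ℝ) ^ Np) := by simp [sub_eq_add_neg]
    _ ≤ ∏ l : Fin k, ∑ z : Fin Np → Fin Nq → Fin n × Fin m,
          if |medianOfMeans H B (fun a => V a l) z - (fun a => V a l) ⬝ᵥ (H *ᵥ B)| ≤ e then
            ∏ a, ∏ b, zProb B (fun a => V a l) (z a b) else 0 :=
        Finset.prod_le_prod (fun l _ => by linarith)
          fun l _ => medianOfMeans_success H hNp hNq hB (hV l) he (h l)
    _ = _ := by
        rw [Fintype.prod_sum]
        refine Finset.sum_congr rfl fun z _ => ?_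
        rw [Finset.prod_ite_zero]
        simp only [Finset.mem_univ, true_imp_iff]
        rfl

end InnerProduct

/-! ### Analysis of the procedure -/

/-- The sample size makes the deviation bound of `sampledR_concentration` at most `η / 4` for the
radius `ε σ_min² / 10`. That bound involves `‖H‖_F⁴`, whereas the sample size is proportional to
`‖H‖_F²`; the difference is made up by `‖H‖_F² ≤ k ‖H‖² ≤ k² ‖H‖⁴`. -/
theorem two_mul_exp_neg_le {n m : ℕ} {H : Matrix (Fin n) (Fin m) ℝ} {ε η : ℝ} (hn : 0 < n)
    (hk : 0 < H.rank) (hS : 1 ≤ specNorm H) (hε : 0 < ε) (hη : 0 < η) (hη1 : η < 1) :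
    2 * Real.exp (-((ε * sigmaMin H ^ 2 / 10) ^ 2 * (sampleSize H ε η : ℝ) /
      (8 * frobNorm H ^ 4))) ≤ η / 4 := by
  have hn' : (1 : ℝ) ≤ n := by exact_mod_cast hn
  have hk' : (1 : ℝ) ≤ H.rank := by exact_mod_cast hk
  have hσ := sigmaMin_pos hk
  have hF : 0 < frobNorm H := by linarith [specNorm_le_frobNorm H]
  set L := Real.log (8 * n / η)
  have hL : 0 ≤ L := Real.log_nonneg ((one_le_div hη).2 (by linarith))
  have hs : 85 ^ 2 * (H.rank : ℝ) ^ 2 * condNumber H ^ 4 * L * frobNorm H ^ 2 / (9 * ε ^ 2) ≤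
      (sampleSize H ε η : ℝ) := Nat.le_ceil _
  have hkey : L ≤ (ε * sigmaMin H ^ 2 / 10) ^ 2 * (sampleSize H ε η : ℝ) /
      (8 * frobNorm H ^ 4) := by
    rw [le_div_iff₀ (by positivity)]
    have h1 := mul_le_mul_of_nonneg_left hs (sq_nonneg (ε * sigmaMin H ^ 2 / 10))
    refine le_trans ?_ h1
    have e1 : (ε * sigmaMin H ^ 2 / 10) ^ 2 *
        (85 ^ 2 * (H.rank : ℝ) ^ 2 * condNumber H ^ 4 * L * frobNorm H ^ 2 / (9 * ε ^ 2)) =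
        L * (7225 / 900 * (H.rank ^ 2 * specNorm H ^ 4) * frobNorm H ^ 2) := by
      rw [condNumber]
      field_simp
      ring
    rw [e1]
    refine mul_le_mul_of_nonneg_left ?_ hL
    have h2 : frobNorm H ^ 2 ≤ H.rank ^ 2 * specNorm H ^ 4 := by
      calc _ ≤ H.rank * specNorm H ^ 2 := frobNorm_sq_le_rank_mul H
        _ = (H.rank * specNorm H ^ 2) ^ 1 := (pow_one _).symm
        _ ≤ (H.rank * specNorm H ^ 2) ^ 2 :=
            pow_le_pow_right₀ (one_le_mul_of_one_le_of_one_le hk' (one_le_pow₀ hS)) (by norm_num)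
        _ = _ := by ring
    have h3 := mul_le_mul_of_nonneg_right h2 (sq_nonneg (frobNorm H))
    have h4 : 0 ≤ frobNorm H ^ 2 * frobNorm H ^ 2 := by positivity
    nlinarith
  calc _ ≤ 2 * Real.exp (-L) := by gcongr
    _ = 2 * (η / (8 * n)) := by
        rw [Real.exp_neg, Real.exp_log (by positivity), inv_div]
    _ ≤ 2 * (η / (8 * 1)) := by gcongr
    _ = _ := by ring

theorem rank_le_sampleSize {n m : ℕ} {H : Matrix (Fin n) (Fin m) ℝ} {B : Fin m → ℝ} {ε η : ℝ}
    (hn : 0 < n) (hB : H *ᵥ B ≠ 0) (hS : 1 ≤ specNorm H) (hε : 0 < ε) (hε1 : ε ≤ 1) (hη : 0 < η)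
    (hη1 : η < 1) : H.rank ≤ sampleSize H ε η := by
  have hk := rank_pos_of_mulVec_ne_zero hB
  have hn' : (1 : ℝ) ≤ n := by exact_mod_cast hn
  have hk' : (1 : ℝ) ≤ H.rank := by exact_mod_cast hk
  have hκ : 1 ≤ condNumber H := (one_le_div (sigmaMin_pos hk)).2 (sigmaMin_le_specNorm hB)
  have hF : 1 ≤ frobNorm H := hS.trans (specNorm_le_frobNorm H)
  have hL : 1 ≤ Real.log (8 * n / η) := by
    rw [Real.le_log_iff_exp_le (by positivity), le_div_iff₀ hη]
    nlinarith [Real.exp_one_lt_d9, Real.exp_pos 1]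
  have h : (H.rank : ℝ) ≤ 85 ^ 2 * (H.rank : ℝ) ^ 2 * condNumber H ^ 4 *
      Real.log (8 * n / η) * frobNorm H ^ 2 / (9 * ε ^ 2) := by
    rw [le_div_iff₀ (by positivity)]
    have h1 : 1 ≤ (H.rank : ℝ) * condNumber H ^ 4 * Real.log (8 * n / η) * frobNorm H ^ 2 :=
      one_le_mul_of_one_le_of_one_le (one_le_mul_of_one_le_of_one_le
        (one_le_mul_of_one_le_of_one_le hk' (one_le_pow₀ hκ)) hL) (one_le_pow₀ hF)
    calc (H.rank : ℝ) * (9 * ε ^ 2) ≤ H.rank * (85 ^ 2 * 1) := by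
          gcongr
          · norm_num
          · exact pow_le_one₀ hε.le hε1
      _ ≤ H.rank * (85 ^ 2 * ((H.rank : ℝ) * condNumber H ^ 4 * Real.log (8 * n / η) *
          frobNorm H ^ 2)) := by gcongr
      _ = _ := by ring
  have h2 : (H.rank : ℝ) ≤ (sampleSize H ε η : ℝ) := h.trans (Nat.le_ceil _)
  exact_mod_cast h2

/-- Accurate sketches and accurate inner product estimates give an accurate output. -/
theorem output_good {n m s : ℕ} {H : Matrix (Fin n) (Fin m) ℝ} {R : Matrix (Fin n) (Fin s) ℝ}
    {B : Fin m → ℝ} {ε : ℝ} (hB : H *ᵥ B ≠ 0) (hε : 0 < ε) (hε1 : ε ≤ 1)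
    {V : Matrix (Fin n) (Fin H.rank) ℝ} {P : Matrix (Fin s) (Fin H.rank) ℝ}
    {M : Matrix (Fin m) (Fin s) ℝ} (hR : R = H * M) (hVP : V = R * P)
    (hV : ∀ x, vecNorm ((Vᵀ * V - 1) *ᵥ x) ≤ ε / 8 * vecNorm x) {q : Fin H.rank → ℝ}
    (hq : ∀ l, |q l - (Vᵀ *ᵥ (H *ᵥ B)) l| ≤ ε * vecNorm (H *ᵥ B) / (4 * √H.rank)) :
    V *ᵥ q ≠ 0 ∧ tvDist (lsDist (V *ᵥ q)) (lsDist (H *ᵥ B)) ≤ ε := by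
  have hk : (0 : ℝ) < H.rank := by exact_mod_cast rank_pos_of_mulVec_ne_zero hB
  have hy := vecNorm_pos hB
  obtain ⟨x, hx⟩ := exists_mulVec_eq (M := M * P) (by rw [hVP, hR, Matrix.mul_assoc])
    (by linarith) hV B
  have hq' : vecNorm (q - Vᵀ *ᵥ (H *ᵥ B)) ≤ ε / 4 * vecNorm (H *ᵥ B) := by
    refine le_of_sq_le_sq ?_ (by positivity)
    rw [vecNorm_sq]
    calc _ ≤ ∑ _l : Fin H.rank, (ε * vecNorm (H *ᵥ B) / (4 * √H.rank)) ^ 2 :=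
          Finset.sum_le_sum fun l _ => by
            rw [← sq_abs]
            exact pow_le_pow_left₀ (abs_nonneg _) (hq l) 2
      _ = _ := by
          simp only [Finset.sum_const, Finset.card_univ, Fintype.card_fin, nsmul_eq_mul, div_pow,
            mul_pow, Real.sq_sqrt hk.le]
          field_simp
  rw [← hx] at hq' hy ⊢
  have hclose := vecNorm_mulVec_sub_le hε hε1 hV hq'
  have hne : V *ᵥ q ≠ 0 := by
    intro h0
    rw [h0, zero_sub, ← neg_one_smul ℝ, vecNorm_smul] at hclose
    norm_num at hclose
    nlinarith
  refine ⟨hne, (tvDist_lsDist_le hne (hx ▸ hB)).trans ?_⟩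
  rw [div_le_iff₀ hy]
  linarith

open Classical in
/-- A lower bound for the probability of success in two stages. -/
theorem mul_le_sum_mul_of_good {α : Type*} [Fintype α] {w f : α → ℝ} {good : α → Prop} {a b : ℝ}
    (hw : ∀ i, 0 ≤ w i) (hf : ∀ i, 0 ≤ f i) (hb : 0 ≤ b)
    (ha : a ≤ ∑ i, if good i then w i else 0) (h : ∀ i, good i → w i ≠ 0 → b ≤ f i) :
    a * b ≤ ∑ i, w i * f i := by
  refine (mul_le_mul_of_nonneg_right ha hb).trans ?_
  rw [Finset.sum_mul]
  refine Finset.sum_le_sum fun i _ => ?_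
  split_ifs with hi
  · rcases eq_or_ne (w i) 0 with h0 | h0
    · simp [h0]
    · exact mul_le_mul_of_nonneg_left (h i hi h0) (hw i)
  · rw [zero_mul]
    exact mul_nonneg (hw i) (hf i)

theorem samplesWeight_nonneg {n m k Np Nq : ℕ} (B : Fin m → ℝ) (V : Matrix (Fin n) (Fin k) ℝ)
    (z : Fin k → Fin Np → Fin Nq → Fin n × Fin m) : 0 ≤ samplesWeight B V z :=
  Finset.prod_nonneg fun _ _ => Finset.prod_nonneg fun _ _ =>
    Finset.prod_nonneg fun _ _ => zProb_nonneg _ _ _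

open Classical in
/-- The success probability of the inner product estimates, and with it of the output, once the
matrix `V` has nearly orthonormal columns. -/
theorem output_success {n m s Np Nq : ℕ} {H : Matrix (Fin n) (Fin m) ℝ}
    {R : Matrix (Fin n) (Fin s) ℝ} {B : Fin m → ℝ} {ε η : ℝ} (hB : H *ᵥ B ≠ 0) (hε : 0 < ε)
    (hε1 : ε ≤ 1) (hF : 0 < frobNorm H) (hη : 0 < η) (hη1 : η < 1)
    (hNq : 512 * H.rank * frobNorm H ^ 2 * vecNorm B ^ 2 / (ε * vecNorm (H *ᵥ B)) ^ 2 ≤ (Nq : ℝ))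
    (hNp : 512 * Real.log (2 * H.rank / η) ≤ (Np : ℝ))
    {V : Matrix (Fin n) (Fin H.rank) ℝ} {P : Matrix (Fin s) (Fin H.rank) ℝ}
    {M : Matrix (Fin m) (Fin s) ℝ} (hR : R = H * M) (hVP : V = R * P)
    (hV : ∀ x, vecNorm ((Vᵀ * V - 1) *ᵥ x) ≤ ε / 8 * vecNorm x) {good : (Fin n → ℝ) → Prop}
    (hgood : ∀ v, v ≠ 0 → tvDist (lsDist v) (lsDist (H *ᵥ B)) ≤ ε → good v) :
    1 - η / 2 ≤ ∑ z : Fin H.rank → Fin Np → Fin Nq → Fin n × Fin m,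
      if good (V *ᵥ qHat H B V z) then samplesWeight B V z else 0 := by
  have hk0 := rank_pos_of_mulVec_ne_zero hB
  have hk : (1 : ℝ) ≤ H.rank := by exact_mod_cast hk0
  have hy := vecNorm_pos hB
  have hB0 : B ≠ 0 := by
    rintro rfl
    exact hB (Matrix.mulVec_zero H)
  have hBn := vecNorm_pos hB0
  have hlog : 0 < Real.log (2 * H.rank / η) := Real.log_pos ((one_lt_div hη).2 (by linarith))
  have hNp0 : 0 < Np := by
    have : (0 : ℝ) < Np := by linarith
    exact_mod_cast this
  have hNq' : (0 : ℝ) < Nq := lt_of_lt_of_le (by positivity) hNq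
  have hNq0 : 0 < Nq := by exact_mod_cast hNq'
  have hcol : ∀ l, |vecNorm (fun a => V a l) ^ 2 - 1| ≤ 1 / 8 := by
    intro l
    have h := abs_vecNorm_mulVec_sq_sub_le hV (Pi.single l 1)
    have h1 : vecNorm (Pi.single l (1 : ℝ) : Fin H.rank → ℝ) ^ 2 = 1 := by
      rw [vecNorm_sq_eq_dotProduct]; simp
    rw [h1, Matrix.mulVec_single_one] at h
    exact h.trans (by linarith)
  have hV0 : ∀ l, (fun a => V a l) ≠ 0 := by
    intro l h0
    have h := hcol l
    rw [h0, vecNorm_eq_zero.2 rfl] at h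
    norm_num at h
  have hη' : (1 / 2 : ℝ) ^ Np ≤ η / (2 * H.rank) := by
    have hle : Real.log (2 * H.rank / η) ≤ Np * Real.log 2 := by
      nlinarith [Real.log_two_gt_d9]
    rw [← Real.log_pow, Real.log_le_log_iff (by positivity) (by positivity)] at hle
    rw [one_div, inv_pow, ← inv_div]
    exact inv_anti₀ (by positivity) hle
  -- With `‖ṽ‖² ≤ 2` and the tolerance `ε ‖H B‖ / (4 √k)`, a failure probability of `1 / 16` for the
  -- means needs `Nq` to be `2 * 16 * 16 = 512` times `k ‖H‖_F² ‖B‖² / (ε ‖H B‖)²`.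
  have hvar : ∀ l, vecNorm (fun a => V a l) ^ 2 * vecNorm B ^ 2 * frobNorm H ^ 2 /
      (Nq * (ε * vecNorm (H *ᵥ B) / (4 * √H.rank)) ^ 2) ≤ 1 / 16 := by
    intro l
    have h1 : vecNorm (fun a => V a l) ^ 2 ≤ 2 := by
      have := (abs_le.1 (hcol l)).2
      linarith
    rw [div_le_iff₀ (by positivity)] at hNq ⊢
    rw [div_pow, mul_pow 4, Real.sq_sqrt (by linarith)]
    calc _ ≤ 2 * vecNorm B ^ 2 * frobNorm H ^ 2 := by gcongr
      _ = (512 * H.rank * frobNorm H ^ 2 * vecNorm B ^ 2) / (256 * H.rank) := by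
          field_simp
          norm_num
      _ ≤ (Nq * (ε * vecNorm (H *ᵥ B)) ^ 2) / (256 * H.rank) := by gcongr
      _ = _ := by
          field_simp
          norm_num
  refine (qHat_success H hk0 hNp0 hNq0 hB0 hV0 (by positivity) hη' hvar).trans
    (Finset.sum_le_sum fun z _ => ?_)
  by_cases hz : ∀ l, |qHat H B V z l - (Vᵀ *ᵥ (H *ᵥ B)) l| ≤
      ε * vecNorm (H *ᵥ B) / (4 * √H.rank)
  · obtain ⟨h1, h2⟩ := output_good hB hε hε1 hR hVP hV hz
    rw [if_pos hz, if_pos (hgood _ h1 h2)]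
  · rw [if_neg hz]
    split_ifs
    · exact samplesWeight_nonneg _ _ _
    · exact le_rfl

open Classical in
theorem outputProb_eq {n m : ℕ} (k s Np Nq : ℕ) (H : Matrix (Fin n) (Fin m) ℝ) (B : Fin m → ℝ)
    (svd : ∀ A : Matrix (Fin s) (Fin s) ℝ, SVD A) (good : (Fin n → ℝ) → Prop) :
    outputProb k s Np Nq H B svd good =
      ∑ c : Fin s → Fin m, colsWeight H c * ∑ d : Fin s → Fin s × Fin n,
        rowsWeight (sampledR H c) d * ∑ z : Fin k → Fin Np → Fin Nq → Fin n × Fin m,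
          if good (hHat k H B svd c d z) then
            samplesWeight B (approxV k (sampledR H c)
              (svd (sampledC (sampledR H c) fun r => (d r).2))) z
          else 0 := by
  simp only [outputProb, Finset.mul_sum, mul_ite, mul_zero, mul_assoc]

/-- The whole procedure: the two sketches are each accurate with probability at least `1 - η / 4`,
and given that they are, the output is with probability at least `1 - η / 2`. -/
theorem one_sub_le_outputProb {n m : ℕ} {H : Matrix (Fin n) (Fin m) ℝ} {B : Fin m → ℝ} {ε η : ℝ}
    {s Np Nq : ℕ} (svd : ∀ A : Matrix (Fin s) (Fin s) ℝ, SVD A) (hS : 1 ≤ specNorm H)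
    (hB : H *ᵥ B ≠ 0) (hε : 0 < ε) (hε1 : ε ≤ 1) (hη : 0 < η) (hη1 : η < 1)
    (hs : s = sampleSize H ε η)
    (hNq : 512 * H.rank * frobNorm H ^ 2 * vecNorm B ^ 2 / (ε * vecNorm (H *ᵥ B)) ^ 2 ≤ (Nq : ℝ))
    (hNp : 512 * Real.log (2 * H.rank / η) ≤ (Np : ℝ)) {good : (Fin n → ℝ) → Prop}
    (hgood : ∀ v, v ≠ 0 → tvDist (lsDist v) (lsDist (H *ᵥ B)) ≤ ε → good v) :
    1 - η ≤ outputProb H.rank s Np Nq H B svd good := by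
  classical
  have hn : 0 < n := by
    rcases Nat.eq_zero_or_pos n with rfl | h
    · exact absurd (Subsingleton.elim _ _) hB
    · exact h
  have hk := rank_pos_of_mulVec_ne_zero hB
  have hks : H.rank ≤ s := hs ▸ rank_le_sampleSize hn hB hS hε hε1 hη hη1
  have hs0 : 0 < s := hk.trans_le hks
  have hF : 0 < frobNorm H := by linarith [specNorm_le_frobNorm H]
  have hσ := sigmaMin_pos hk
  set θ := ε * sigmaMin H ^ 2 / 10 with hθ
  have hθ0 : 0 ≤ θ := by positivity
  have hexp := two_mul_exp_neg_le hn hk hS hε hη hη1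
  rw [← hs, ← hθ] at hexp
  have hθσ : 8 * θ ≤ ε * (sigmaMin H ^ 2 - 2 * θ) := by
    have : 0 ≤ ε * (1 - ε) * sigmaMin H ^ 2 :=
      mul_nonneg (mul_nonneg hε.le (by linarith)) (sq_nonneg _)
    rw [hθ]
    nlinarith
  have hcols := sampledR_concentration hF.ne' (colProb H) (colProb_nonneg H) id (fun f => rfl) hs0
    hθ0
  rw [outputProb_eq]
  have hrows_nonneg : ∀ (c : Fin s → Fin m) (d : Fin s → Fin s × Fin n),
      0 ≤ rowsWeight (sampledR H c) d := fun c d =>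
    Finset.prod_nonneg fun _ _ => mul_nonneg (by positivity) (lsDist_nonneg _ _)
  have hinner_nonneg : ∀ (c : Fin s → Fin m) (d : Fin s → Fin s × Fin n),
      0 ≤ ∑ z : Fin H.rank → Fin Np → Fin Nq → Fin n × Fin m,
        if good (hHat H.rank H B svd c d z) then
          samplesWeight B (approxV H.rank (sampledR H c)
            (svd (sampledC (sampledR H c) fun r => (d r).2))) z
        else 0 := fun c d => Finset.sum_nonneg fun z _ => by
    split_ifs
    · exact samplesWeight_nonneg _ _ _
    · exact le_rfl
  have hfinal : 1 - η ≤ (1 - η / 4) * ((1 - η / 4) * (1 - η / 2)) := by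
    nlinarith [mul_nonneg (sq_nonneg η) (sub_nonneg.2 hη1.le)]
  refine hfinal.trans ?_
  refine mul_le_sum_mul_of_good (fun c => Finset.prod_nonneg fun _ _ => colProb_nonneg H _)
    (fun c => Finset.sum_nonneg fun d _ => mul_nonneg (hrows_nonneg c d) (hinner_nonneg c d))
    (mul_nonneg (by linarith) (by linarith)) ((sub_le_sub_left hexp 1).trans hcols) ?_
  intro c hRc hc
  have hc' : ∀ t, colProb H (c t) ≠ 0 := fun t => Finset.prod_ne_zero_iff.1 hc t (Finset.mem_univ t)
  have hFR := frobNorm_sampledR hF.ne' hs0 hc'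
  have hFRt : frobNorm (sampledR H c)ᵀ = frobNorm H := by rw [frobNorm_transpose, hFR]
  have hrows := sampledR_concentration (A := (sampledR H c)ᵀ) (by rw [hFRt]; exact hF.ne')
    (fun d : Fin s × Fin n => 1 / (s : ℝ) * lsDist (fun a => sampledR H c a d.1) d.2)
    (fun d => mul_nonneg (by positivity) (lsDist_nonneg _ _)) Prod.snd
    (sum_row_marginal hF.ne' hs0 hc') hs0 hθ0
  rw [hFRt] at hrows
  refine mul_le_sum_mul_of_good (hrows_nonneg c) (hinner_nonneg c) (by linarith)
    ((sub_le_sub_left hexp 1).trans hrows) ?_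
  intro d hCd _
  obtain ⟨M, hM⟩ := exists_sampledR_eq_mul H c
  have hC : frobNorm ((sampledC (sampledR H c) fun r => (d r).2)ᵀ *
      (sampledC (sampledR H c) fun r => (d r).2) - (sampledR H c)ᵀ * sampledR H c) ≤ θ := by
    rw [sampledC_eq_transpose]
    exact hCd
  have hμ : 0 < sigmaMin H ^ 2 - 2 * θ := by
    have : 0 < ε * (sigmaMin H ^ 2 - 2 * θ) := lt_of_lt_of_le (by positivity) hθσ
    exact pos_of_mul_pos_right this hε.le
  refine output_success hB hε hε1 hF hη hη1 hNq hNp hM (SVD.approxV_eq _ hks _) ?_ hgood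
  intro x
  refine (vecNorm_gram_sub_one_le hks (sampledR H c) _ hC hμ (fun l =>
    sigma_sq_lower_bound H (sampledR H c) _ hRc hC (by linarith) l.2) x).trans ?_
  refine mul_le_mul_of_nonneg_right ?_ (vecNorm_nonneg x)
  rw [div_le_iff₀ hμ]
  linarith

end ConicalHull

end

theorem theorem3 :
    ∃ K : ℝ, 0 < K ∧
      ∀ (n m : ℕ) (H : Matrix (Fin n) (Fin m) ℝ) (B : Fin m → ℝ) (ε η : ℝ) (s Np Nq : ℕ)
        (svd : ∀ A : Matrix (Fin s) (Fin s) ℝ, ConicalHull.SVD A),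
        1 ≤ ConicalHull.specNorm H →
        H *ᵥ B ≠ 0 →
        0 < ε → ε ≤ 1 →
        0 < η → η < 1 →
        s = ConicalHull.sampleSize H ε η →
        K * H.rank * ConicalHull.frobNorm H ^ 2 * ConicalHull.vecNorm B ^ 2
            / (ε * ConicalHull.vecNorm (H *ᵥ B)) ^ 2 ≤ (Nq : ℝ) →
        K * Real.log (2 * H.rank / η) ≤ (Np : ℝ) →
        1 - η ≤ ConicalHull.outputProb H.rank s Np Nq H B svd
          (fun Hhat => Hhat ≠ 0 ∧
            ConicalHull.tvDist (ConicalHull.lsDist Hhat) (ConicalHull.lsDist (H *ᵥ B)) ≤ ε) := by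
  refine ⟨512, by norm_num, ?_⟩
  intro n m H B ε η s Np Nq svd hS hB hε hε1 hη hη1 hs hNq hNp
  exact ConicalHull.one_sub_le_outputProb svd hS hB hε hε1 hη hη1 hs hNq hNp
    fun v h1 h2 => ⟨h1, h2⟩
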